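/- Let $n,m\ge 1$ be integers, $0<\alpha<n$, $0<\beta<m$, $\rho\ge 1$ and $1<q<\infty$. For $x\in\mathbb R^n\setminus\{0\}$, $y\in\mathbb R^m$ put \[ \Omega(x,y)=\Big(\frac1{|x|}\Big)^{n-\alpha}\Big[\frac1{|x|^{\rho}+|y|}\Big]^{m-\beta}, \qquad \mathbf I^{\rho}_{\alpha\beta}f(x,y)=\iint_{\mathbb R^n\times\mathbb R^m} f(u,v)\,\Omega(x-u,y-v)\,du\,dv . \] An $H^1$-atom on $\mathbb R^{n+m}=\mathbb R^n\times\mathbb R^m$ is a (real- or complex-valued) measurable function $a$ for which there is a cube $Q\subset\mathbb R^{n+m}$ with sides parallel to the axes such that $\operatorname{supp}a\subset Q$, $|a|\le 1/\mathrm{vol}(Q)$ and $\int_Q a=0$. The space $H^1(\mathbb R^{n+m})$ consists of all $f=\sum_k\lambda_k a_k$ (convergence in $L^1$) with atoms $a_k$ and $\sum_k|\lambda_k|<\infty$, and $\|f\|_{H^1}$ is the infimum of $\sum_k|\lambda_k|$ over all such decompositions. For every $f\in H^1(\mathbb R^{n+m})$ the integral defining $\mathbf I^{\rho}_{\alpha\beta}f$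 converges absolutely almost everywhere. Moreover, there is a constant $B<\infty$ (depending only on $n,m,\alpha,\beta,\rho,q$) such that \[ \mathbf I^{\rho}_{\alpha\beta}f\in L^q(\mathbb R^{n+m}),\qquad \|\mathbf I^{\rho}_{\alpha\beta}f\|_{L^q(\mathbb R^{n+m})}\le B\,\|f\|_{H^1(\mathbb R^{n+m})}\qquad\text{for all } f\in H^1(\mathbb R^{n+m}) \] if and only if \[ \frac{\alpha}{n}>\frac{\beta}{m}\qquad\text{and}\qquad \frac{\alpha+\rho\beta}{n+\rho m}=1-\frac1q . \] -/

import Mathlib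

open MeasureTheory Filter Topology
open scoped ENNReal NNReal

namespace FlagFractional

/-- The space `ℝⁿ × ℝᵐ = ℝⁿ⁺ᵐ`, with Lebesgue measure `volume`; each factor carries its Euclidean
norm. (The norm of the product itself is never used.) -/
abbrev Space (n m : ℕ) : Type := EuclideanSpace ℝ (Fin n) × EuclideanSpace ℝ (Fin m)

/-- The kernel `Ω(x, y) = (1 / |x|) ^ (n - α) * (1 / (|x| ^ ρ + |y|)) ^ (m - β)` for `x ≠ 0`.
The value on the null set `x = 0` is irrelevant. -/
noncomputable def kernel (n m : ℕ) (α β ρ : ℝ) (z : Space n m) : ℝ :=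
  (1 / ‖z.1‖) ^ ((n : ℝ) - α) * (1 / (‖z.1‖ ^ ρ + ‖z.2‖)) ^ ((m : ℝ) - β)

/-- The fractional integral `(I f)(z) = ∫ Ω(z - w) f(w) dw`. -/
noncomputable def fracIntegral {𝕜 : Type*} [RCLike 𝕜] (n m : ℕ) (α β ρ : ℝ)
    (f : Space n m → 𝕜) (z : Space n m) : 𝕜 :=
  ∫ w, kernel n m α β ρ (z - w) • f w

/-- The closed cube in `ℝⁿ⁺ᵐ`, with sides parallel to the coordinate axes, with lower corner `c`
and side length `s`. -/
def cube {n m : ℕ} (c : Space n m) (s : ℝ) : Set (Space n m) :=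
  {z | (∀ i, z.1 i ∈ Set.Icc (c.1 i) (c.1 i + s)) ∧ ∀ j, z.2 j ∈ Set.Icc (c.2 j) (c.2 j + s)}

/-- `a` is an `H¹`-atom: for some cube `Q`, `supp a ⊆ Q`, `|a| ≤ 1 / vol Q` and `∫_Q a = 0`. -/
def IsAtom {𝕜 : Type*} [RCLike 𝕜] {n m : ℕ} (a : Space n m → 𝕜) : Prop :=
  AEStronglyMeasurable a volume ∧
    ∃ (c : Space n m) (s : ℝ), 0 < s ∧ Function.support a ⊆ cube c s ∧
      (∀ z, ‖a z‖ ≤ 1 / (volume (cube c s)).toReal) ∧ ∫ z in cube c s, a z = 0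

/-- `f = ∑ₖ lam k • a k` in `L¹(ℝⁿ⁺ᵐ)`, with atoms `a k` and `∑ₖ |lam k| < ∞`. Finite sums are
included, since `lam k` may vanish. -/
def IsAtomicDecomposition {𝕜 : Type*} [RCLike 𝕜] {n m : ℕ} (f : Space n m → 𝕜)
    (lam : ℕ → 𝕜) (a : ℕ → Space n m → 𝕜) : Prop :=
  Integrable f ∧ (∀ k, IsAtom (a k)) ∧ Summable (fun k => ‖lam k‖) ∧
    Tendsto (fun N : ℕ => eLpNorm (fun z => f z - ∑ k ∈ Finset.range N, lam k * a k z) 1 volume)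
      atTop (𝓝 0)

/-- Membership in the atomic Hardy space `H¹(ℝⁿ⁺ᵐ)`. -/
def MemHardy {𝕜 : Type*} [RCLike 𝕜] {n m : ℕ} (f : Space n m → 𝕜) : Prop :=
  ∃ (lam : ℕ → 𝕜) (a : ℕ → Space n m → 𝕜), IsAtomicDecomposition f lam a

/-- The atomic `H¹` norm: the infimum of `∑ₖ |lam k|` over all atomic decompositions of `f`. -/
noncomputable def hardyNorm {𝕜 : Type*} [RCLike 𝕜] {n m : ℕ} (f : Space n m → 𝕜) : ℝ≥0∞ :=
  ⨅ (lam : ℕ → 𝕜) (a : ℕ → Space n m → 𝕜) (_ : IsAtomicDecomposition f lam a), ∑' k, ‖lam k‖ₑ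

end FlagFractional

/-! Under the dilations (x, y) ↦ (r x, r^ρ y) the kernel Ω is homogeneous, and the balance
condition, rewritten as n - q(n-α) + ρ(m - q(m-β)) = 0, says that Ω^q has the critical degree
-(n+ρm). Given this relation, α/n > β/m is equivalent to q(n-α) < n and to m < q(m-β): Ω^q is
locally integrable in x and integrable at infinity in y. Criticality keeps Ω itself out of L^q, so
the cancellation of atoms is needed.

Sufficiency is a uniform L^q bound on atoms (`exists_lintegral_enorm_fracIntegral_rpow_le`). The
difficulty is that atoms live on isotropic cubes while the kernel scales nonisotropically. A cube of
side about s is put inside the nonisotropic box of radii r, r^ρ with r = max(s, s^{1/ρ}), and space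
is cut in three. Near the box (`exists_setLIntegral_near_le`) Ω is dominated by a product of powers
of |x| and |y|; in one variable the average over the cube is bounded pointwise, in the other it is
bounded in L^q. For |x| ≤ 2r and |y| large (`exists_setLIntegral_farSnd_le`) the two integrability
conditions suffice without cancellation. For |x| > 2r (`exists_setLIntegral_farFst_le`) cancellation
gains a factor r/|x|, which makes the critical integral converge. Since Ω is uniformly integrable
over translates of a box, L¹ convergence of an atomic sum gives local L¹ convergence of the
fractional integrals, and Fatou's lemma carries the bound to H¹.

For necessity the test atoms are dipoles: a box minus its translate, the translation being long
enough to halve the kernel, so that cancellation costs only a factor 2 (`exists_dipole_atom`).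
Dipoles at every scale r force the critical degree; the tail in y of a single dipole forces m <
q(m-β). -/

namespace FlagFractional

/-! ### Integrals of powers of the norm. -/

section PowerIntegrals

variable {E : Type*} [NormedAddCommGroup E]

/-- The extended-real power `‖x‖ ^ (-a)`, equal to `∞` at the origin when `0 < a`. -/
noncomputable def normPow (a : ℝ) (x : E) : ℝ≥0∞ := ‖x‖ₑ ^ (-a)

lemma normPow_of_ne {a : ℝ} {x : E} (hx : x ≠ 0) :
    normPow a x = ENNReal.ofReal (‖x‖ ^ (-a)) := by
  rw [normPow, ← ofReal_norm, ENNReal.ofReal_rpow_of_pos (norm_pos_iff.2 hx)]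

lemma normPow_rpow (a q : ℝ) (x : E) : normPow a x ^ q = normPow (q * a) x := by
  rw [normPow, normPow, ← ENNReal.rpow_mul]; ring_nf

lemma normPow_neg (a : ℝ) (x : E) : normPow a (-x) = normPow a x := by
  simp [normPow]

lemma normPow_anti {a b : ℝ} (hab : a ≤ b) {x : E} (hx : 1 ≤ ‖x‖) :
    normPow b x ≤ normPow a x := by
  have h0 : x ≠ 0 := norm_pos_iff.1 (by linarith)
  rw [normPow_of_ne h0, normPow_of_ne h0]
  exact ENNReal.ofReal_le_ofReal (Real.rpow_le_rpow_of_exponent_le hx (by linarith))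

lemma normPow_le_of_le {a R : ℝ} (ha : 0 ≤ a) (hR : 0 < R) {x : E} (hx : R ≤ ‖x‖) :
    normPow a x ≤ ENNReal.ofReal (R ^ (-a)) := by
  have h0 : x ≠ 0 := norm_pos_iff.1 (by linarith)
  rw [normPow_of_ne h0]
  exact ENNReal.ofReal_le_ofReal (Real.rpow_le_rpow_of_nonpos hR hx (by linarith))

@[fun_prop]
lemma measurable_normPow [MeasurableSpace E] [BorelSpace E] (a : ℝ) :
    Measurable (normPow a : E → ℝ≥0∞) := by
  unfold normPow; fun_prop

variable [NormedSpace ℝ E]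

lemma normPow_smul (a : ℝ) {R : ℝ} (hR : 0 < R) (x : E) :
    normPow a (R • x) = ENNReal.ofReal (R ^ (-a)) * normPow a x := by
  rw [normPow, normPow, enorm_smul, ENNReal.mul_rpow_of_ne_top (by simp) (by simp),
    Real.enorm_of_nonneg hR.le, ENNReal.ofReal_rpow_of_pos hR]

variable [MeasurableSpace E] [BorelSpace E] [FiniteDimensional ℝ E]
  (μ : Measure E) [μ.IsAddHaarMeasure]

local notation "dim" => (Module.finrank ℝ E : ℝ)

lemma lintegral_eq_mul_lintegral_comp_smul {R : ℝ} (hR : 0 < R) {f : E → ℝ≥0∞}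
    (hf : Measurable f) :
    ∫⁻ x, f x ∂μ = ENNReal.ofReal (R ^ dim) * ∫⁻ x, f (R • x) ∂μ := by
  have h := Measure.map_addHaar_smul μ hR.ne'
  have h2 : ∫⁻ x, f (R • x) ∂μ = ∫⁻ x, f x ∂(Measure.map (R • ·) μ) :=
    (lintegral_map hf (measurable_const_smul R)).symm
  rw [h2, h, lintegral_smul_measure, smul_eq_mul, ← mul_assoc, ← ENNReal.ofReal_mul (by positivity),
    abs_of_pos (by positivity), Real.rpow_natCast, mul_inv_cancel₀ (by positivity)]
  simp

lemma exists_setLIntegral_closedBall_zero_normPow_le [Nontrivial E] {a : ℝ} (han : a < dim) :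
    ∃ C : ℝ≥0, ∀ R : ℝ, 0 < R →
      ∫⁻ x in Metric.closedBall (0 : E) R, normPow a x ∂μ ≤ C * ENNReal.ofReal (R ^ (dim - a)) := by
  have hfin : ∫⁻ x in Metric.closedBall (0 : E) 1, normPow a x ∂μ < ∞ := by
    have hint : IntegrableOn (fun x : E => ‖x‖ ^ (-a)) (Metric.closedBall (0 : E) 1) μ :=
      (integrableOn_ball_of_norm_le_rpow (C := 1) (r := 2) Module.finrank_pos han
        (ae_of_all _ fun x => by rw [Real.norm_of_nonneg (by positivity), one_mul])
        (by fun_prop : Measurable fun x : E => ‖x‖ ^ (-a)).aestronglyMeasurable).mono_set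
        (Metric.closedBall_subset_ball (by norm_num))
    have := hint.2
    rw [HasFiniteIntegral] at this
    refine lt_of_le_of_lt (lintegral_mono_ae ?_) this
    have h0 : ∀ᵐ x ∂μ, x ≠ (0 : E) := by simp [ae_iff]
    filter_upwards [ae_restrict_of_ae h0] with x hx
    rw [normPow_of_ne hx, Real.enorm_of_nonneg (by positivity)]
  refine ⟨(∫⁻ x in Metric.closedBall (0 : E) 1, normPow a x ∂μ).toNNReal, fun R hR => ?_⟩
  rw [ENNReal.coe_toNNReal hfin.ne, ← lintegral_indicator Metric.isClosed_closedBall.measurableSet,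
    lintegral_eq_mul_lintegral_comp_smul μ hR
      ((measurable_normPow a).indicator Metric.isClosed_closedBall.measurableSet),
    ← lintegral_indicator Metric.isClosed_closedBall.measurableSet, sub_eq_add_neg,
    Real.rpow_add hR, ENNReal.ofReal_mul (by positivity), mul_comm (lintegral _ _), mul_assoc,
    ← lintegral_const_mul _
      ((measurable_normPow a).indicator Metric.isClosed_closedBall.measurableSet)]
  gcongr with x
  by_cases hx : x ∈ Metric.closedBall (0 : E) 1
  · rw [Set.indicator_of_mem hx]
    refine (Set.indicator_le_self _ _ _).trans ?_
    rw [normPow_smul a hR]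
  · rw [Set.indicator_of_notMem]
    · simp
    · simp only [Metric.mem_closedBall, dist_zero_right, not_le] at hx ⊢
      rw [norm_smul, Real.norm_of_nonneg hR.le]
      nlinarith

/-- Inside the ball of radius R about the origin the centred estimate applies; on the rest of the
given ball the integrand is at most R^(-a), so the volume suffices. The constant therefore does not
depend on the centre. -/
lemma exists_setLIntegral_closedBall_normPow_le [Nontrivial E] {a : ℝ} (ha : 0 ≤ a)
    (han : a < dim) :
    ∃ C : ℝ≥0, ∀ R : ℝ, 0 < R → ∀ c : E,
      ∫⁻ x in Metric.closedBall c R, normPow a x ∂μ ≤ C * ENNReal.ofReal (R ^ (dim - a)) := by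
  obtain ⟨C, hC⟩ := exists_setLIntegral_closedBall_zero_normPow_le μ han
  refine ⟨C + (μ (Metric.closedBall (0 : E) 1)).toNNReal, fun R hR c => ?_⟩
  have hsplit : Metric.closedBall c R ⊆
      Metric.closedBall (0 : E) R ∪ (Metric.closedBall c R \ Metric.closedBall (0 : E) R) :=
    fun x hx => by by_cases h : x ∈ Metric.closedBall (0 : E) R <;> simp [h, hx]
  calc ∫⁻ x in Metric.closedBall c R, normPow a x ∂μ
      ≤ (∫⁻ x in Metric.closedBall (0 : E) R, normPow a x ∂μ) +
        ∫⁻ x in Metric.closedBall c R \ Metric.closedBall (0 : E) R, normPow a x ∂μ :=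
        (lintegral_mono_set hsplit).trans (lintegral_union_le _ _ _)
    _ ≤ C * ENNReal.ofReal (R ^ (dim - a)) +
        (μ (Metric.closedBall (0 : E) 1)).toNNReal * ENNReal.ofReal (R ^ (dim - a)) := by
        gcongr
        · exact hC R hR
        · calc ∫⁻ x in Metric.closedBall c R \ Metric.closedBall (0 : E) R, normPow a x ∂μ
              ≤ ∫⁻ x in Metric.closedBall c R \ Metric.closedBall (0 : E) R,
                ENNReal.ofReal (R ^ (-a)) ∂μ := by
                refine setLIntegral_mono measurable_const fun x hx => ?_
                refine normPow_le_of_le ha hR ?_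
                have := hx.2
                simp only [Metric.mem_closedBall, dist_zero_right, not_le] at this
                exact this.le
            _ ≤ ENNReal.ofReal (R ^ (-a)) * μ (Metric.closedBall c R) := by
                rw [setLIntegral_const]
                gcongr
                exact Set.sdiff_subset
            _ = _ := by
                rw [Measure.addHaar_closedBall' μ c hR.le,
                  ENNReal.coe_toNNReal measure_closedBall_lt_top.ne,
                  ← mul_assoc, ← ENNReal.ofReal_mul (by positivity), mul_comm,
                  sub_eq_add_neg, Real.rpow_add hR, Real.rpow_natCast, mul_comm (R ^ (-a))]
    _ = _ := by push_cast; rw [add_mul]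

lemma exists_setLIntegral_norm_ge_normPow_le [Nontrivial E] {a : ℝ} (han : dim < a) :
    ∃ C : ℝ≥0, ∀ R : ℝ, 0 < R →
      ∫⁻ x in {x : E | R ≤ ‖x‖}, normPow a x ∂μ ≤ C * ENNReal.ofReal (R ^ (dim - a)) := by
  have hmeas : ∀ R : ℝ, MeasurableSet {x : E | R ≤ ‖x‖} := fun R =>
    measurableSet_le measurable_const measurable_norm
  have ha : 0 ≤ a := (Nat.cast_nonneg _).trans han.le
  have hfin : ∫⁻ x in {x : E | 1 ≤ ‖x‖}, normPow a x ∂μ < ∞ := by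
    have := finite_integral_one_add_norm (μ := μ) han
    calc ∫⁻ x in {x : E | 1 ≤ ‖x‖}, normPow a x ∂μ
        ≤ ∫⁻ x in {x : E | 1 ≤ ‖x‖},
          ENNReal.ofReal (2 ^ a) * ENNReal.ofReal ((1 + ‖x‖) ^ (-a)) ∂μ := by
          refine setLIntegral_mono (by fun_prop) fun x hx => ?_
          have hx : 1 ≤ ‖x‖ := hx
          have h0 : x ≠ 0 := norm_pos_iff.1 (by linarith)
          rw [normPow_of_ne h0, ← ENNReal.ofReal_mul (by positivity)]
          refine ENNReal.ofReal_le_ofReal ?_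
          have h1 : (2 * ‖x‖) ^ (-a) ≤ (1 + ‖x‖) ^ (-a) :=
            Real.rpow_le_rpow_of_nonpos (by linarith) (by linarith) (by linarith)
          rw [Real.mul_rpow (by norm_num) (by positivity)] at h1
          calc ‖x‖ ^ (-a) = 2 ^ a * (2 ^ (-a) * ‖x‖ ^ (-a)) := by
                rw [← mul_assoc, ← Real.rpow_add (by norm_num)]; simp
            _ ≤ _ := by gcongr
      _ ≤ ∫⁻ x, ENNReal.ofReal (2 ^ a) * ENNReal.ofReal ((1 + ‖x‖) ^ (-a)) ∂μ :=
          setLIntegral_le_lintegral _ _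
      _ = ENNReal.ofReal (2 ^ a) * ∫⁻ x, ENNReal.ofReal ((1 + ‖x‖) ^ (-a)) ∂μ :=
          lintegral_const_mul _ (by fun_prop)
      _ < ∞ := ENNReal.mul_lt_top (by simp) this
  refine ⟨(∫⁻ x in {x : E | 1 ≤ ‖x‖}, normPow a x ∂μ).toNNReal, fun R hR => ?_⟩
  rw [ENNReal.coe_toNNReal hfin.ne, ← lintegral_indicator (hmeas R),
    lintegral_eq_mul_lintegral_comp_smul μ hR ((measurable_normPow a).indicator (hmeas R)),
    ← lintegral_indicator (hmeas 1), sub_eq_add_neg, Real.rpow_add hR,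
    ENNReal.ofReal_mul (by positivity), mul_comm (lintegral _ _), mul_assoc,
    ← lintegral_const_mul _ ((measurable_normPow a).indicator (hmeas 1))]
  gcongr with x
  by_cases hx : x ∈ {x : E | 1 ≤ ‖x‖}
  · rw [Set.indicator_of_mem hx]
    refine (Set.indicator_le_self _ _ _).trans ?_
    rw [normPow_smul a hR]
  · rw [Set.indicator_of_notMem]
    · simp
    · simp only [Set.mem_ofPred_eq, not_le] at hx ⊢
      rw [norm_smul, Real.norm_of_nonneg hR.le]
      nlinarith

/-- Used with S = |x|^ρ to integrate y out of the q-th power of the kernel. -/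
lemma exists_lintegral_add_norm_rpow_le {b : ℝ} (hb : dim < b) :
    ∃ C : ℝ≥0, ∀ S : ℝ, 0 < S →
      ∫⁻ y : E, ENNReal.ofReal ((S + ‖y‖) ^ (-b)) ∂μ ≤ C * ENNReal.ofReal (S ^ (dim - b)) := by
  have hfin := finite_integral_one_add_norm (μ := μ) hb
  refine ⟨(∫⁻ x : E, ENNReal.ofReal ((1 + ‖x‖) ^ (-b)) ∂μ).toNNReal, fun S hS => ?_⟩
  rw [ENNReal.coe_toNNReal hfin.ne, lintegral_eq_mul_lintegral_comp_smul μ hS (by fun_prop),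
    sub_eq_add_neg, Real.rpow_add hS, ENNReal.ofReal_mul (by positivity), mul_comm (lintegral _ _),
    mul_assoc, ← lintegral_const_mul _
      (by fun_prop : Measurable fun y : E => ENNReal.ofReal ((1 + ‖y‖) ^ (-b)))]
  gcongr with x
  rw [← ENNReal.ofReal_mul (by positivity), norm_smul, Real.norm_of_nonneg hS.le,
    ← Real.mul_rpow hS.le (by positivity), mul_add, mul_one]

/-- At the critical exponent the integrals over |x| ≥ 1 and |x| ≥ 2 agree by scaling. Were they
finite, the shell between would contribute zero, although it contains a ball and the integrand is
positive. Smaller exponents only enlarge the integrand. -/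
lemma setLIntegral_norm_ge_normPow_eq_top [Nontrivial E] {a : ℝ} (ha : a ≤ dim) :
    ∫⁻ x in {x : E | 1 ≤ ‖x‖}, normPow a x ∂μ = ∞ := by
  have hmeas : ∀ R : ℝ, MeasurableSet {x : E | R ≤ ‖x‖} := fun R =>
    measurableSet_le measurable_const measurable_norm
  by_contra hne
  have hle : ∫⁻ x in {x : E | 1 ≤ ‖x‖}, normPow dim x ∂μ ≤
      ∫⁻ x in {x : E | 1 ≤ ‖x‖}, normPow a x ∂μ :=
    setLIntegral_mono (measurable_normPow a) fun x hx => normPow_anti ha hx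
  have hfin : ∫⁻ x in {x : E | 1 ≤ ‖x‖}, normPow dim x ∂μ ≠ ∞ :=
    (lt_of_le_of_lt hle (lt_top_iff_ne_top.2 hne)).ne
  have hscale : ∫⁻ x in {x : E | 2 ≤ ‖x‖}, normPow dim x ∂μ =
      ∫⁻ x in {x : E | 1 ≤ ‖x‖}, normPow dim x ∂μ := by
    rw [← lintegral_indicator (hmeas 2), lintegral_eq_mul_lintegral_comp_smul μ two_pos
      ((measurable_normPow dim).indicator (hmeas 2)), ← lintegral_indicator (hmeas 1),
      ← lintegral_const_mul _ (show Measurable fun x : E =>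
        {x : E | 2 ≤ ‖x‖}.indicator (normPow dim) ((2 : ℝ) • x) from
        ((measurable_normPow dim).indicator (hmeas 2)).comp (measurable_const_smul 2))]
    refine lintegral_congr fun x => ?_
    by_cases hx : 1 ≤ ‖x‖
    · rw [Set.indicator_of_mem (by simpa [norm_smul] using hx), Set.indicator_of_mem (by exact hx),
        normPow_smul _ two_pos, ← mul_assoc, ← ENNReal.ofReal_mul (by positivity),
        ← Real.rpow_add two_pos]
      simp
    · rw [Set.indicator_of_notMem (by simpa [norm_smul] using hx),
        Set.indicator_of_notMem (by exact hx), mul_zero]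
  have hsub : {x : E | 2 ≤ ‖x‖} ⊆ {x : E | 1 ≤ ‖x‖} := fun x (hx : 2 ≤ ‖x‖) =>
    show 1 ≤ ‖x‖ by linarith
  have hsplit := lintegral_inter_add_sdiff (μ := μ) (fun x : E => normPow dim x)
    {x : E | 1 ≤ ‖x‖} (hmeas 2)
  rw [Set.inter_eq_self_of_subset_right hsub, hscale] at hsplit
  have hzero : ∫⁻ x in {x : E | 1 ≤ ‖x‖} \ {x : E | 2 ≤ ‖x‖}, normPow dim x ∂μ = 0 :=
    (ENNReal.add_right_inj hfin).1 (by rw [hsplit, add_zero])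
  rw [setLIntegral_eq_zero_iff ((hmeas 1).diff (hmeas 2)) (measurable_normPow dim)] at hzero
  obtain ⟨v, hv⟩ := exists_norm_eq E (show (0 : ℝ) ≤ 3 / 2 by norm_num)
  have hball : Metric.ball v (1 / 2) ⊆ {x : E | 1 ≤ ‖x‖} \ {x : E | 2 ≤ ‖x‖} := fun x hx => by
    rw [mem_ball_iff_norm] at hx
    have h1 := norm_sub_norm_le v x
    have h2 := norm_sub_norm_le x v
    rw [norm_sub_rev] at h1
    simp only [Set.mem_sdiff, Set.mem_ofPred_eq, not_le]
    constructor <;> linarith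
  have hnull : μ (Metric.ball v (1 / 2)) = 0 := by
    refine measure_mono_null (fun x hx => ?_) (ae_iff.1 hzero)
    have hx' := hball hx
    have h0 : x ≠ 0 := norm_pos_iff.1 (by have : 1 ≤ ‖x‖ := hx'.1; linarith)
    simp only [Set.mem_ofPred_eq, Classical.not_imp]
    refine ⟨hx', ?_⟩
    rw [normPow_of_ne h0, ENNReal.ofReal_eq_zero, not_le]
    have := norm_pos_iff.2 h0
    positivity
  exact (Metric.measure_ball_pos μ v (by norm_num)).ne' hnull

end PowerIntegrals

/-! ### Pointwise size and smoothness of the kernel. -/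

section Kernel

lemma exists_abs_rpow_sub_one_le (p : ℝ) {c d : ℝ} (hc : 0 < c) (hc1 : c ≤ 1) (hd : 1 ≤ d) :
    ∃ C : ℝ, 0 ≤ C ∧ ∀ t ∈ Set.Icc c d, |t ^ p - 1| ≤ C * |t - 1| := by
  have hcont : ContinuousOn (fun t : ℝ => p * t ^ (p - 1)) (Set.Icc c d) := fun t ht =>
    (continuousAt_const.mul (Real.continuousAt_rpow_const _ _
      (Or.inl (hc.trans_le ht.1).ne'))).continuousWithinAt
  obtain ⟨C, hC⟩ := isCompact_Icc.exists_bound_of_continuousOn hcont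
  have h1 : (1 : ℝ) ∈ Set.Icc c d := ⟨hc1, hd⟩
  refine ⟨C, (norm_nonneg _).trans (hC 1 h1), fun t ht => ?_⟩
  have := (convex_Icc c d).norm_image_sub_le_of_norm_hasDerivWithin_le
    (f := fun t : ℝ => t ^ p) (f' := fun t => p * t ^ (p - 1)) (C := C)
    (fun x hx => (Real.hasDerivAt_rpow_const (Or.inl (hc.trans_le hx.1).ne')).hasDerivWithinAt)
    hC h1 ht
  simpa using this

/-- Relative smoothness of the radial profile of the kernel away from `X = 0`. -/
lemma exists_abs_profile_sub_le (a b : ℝ) {ρ : ℝ} (hρ : 1 ≤ ρ) :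
    ∃ C : ℝ, 0 ≤ C ∧ ∀ r X p Y Y' : ℝ, 0 < r → 2 * r < X → |p - X| ≤ r → 0 ≤ Y → 0 ≤ Y' →
      |Y' - Y| ≤ r ^ ρ →
      |p ^ (-a) * (p ^ ρ + Y') ^ (-b) - X ^ (-a) * (X ^ ρ + Y) ^ (-b)| ≤
        C * (r / X) * (X ^ (-a) * (X ^ ρ + Y) ^ (-b)) := by
  obtain ⟨C₁, hC₁, h₁⟩ := exists_abs_rpow_sub_one_le ρ (c := 1 / 2) (d := 3 / 2)
    (by norm_num) (by norm_num) (by norm_num)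
  obtain ⟨C₂, hC₂, h₂⟩ := exists_abs_rpow_sub_one_le (-a) (c := 1 / 2) (d := 3 / 2)
    (by norm_num) (by norm_num) (by norm_num)
  have hc : (1 / 2 : ℝ) ^ ρ / 2 ≤ 1 := by
    have := Real.rpow_le_one (x := 1 / 2) (z := ρ) (by norm_num) (by norm_num) (by linarith)
    linarith
  obtain ⟨C₃, hC₃, h₃⟩ := exists_abs_rpow_sub_one_le (-b) (c := (1 / 2 : ℝ) ^ ρ / 2)
    (d := C₁ + 2) (by positivity) hc (by linarith)
  refine ⟨C₂ + C₃ * (C₁ + 1) + C₂ * (C₃ * (C₁ + 1)), by positivity, ?_⟩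
  intro r X p Y Y' hr hX hp hY hY' hYY
  have hX0 : 0 < X := by linarith
  obtain ⟨hp1, hp2⟩ := abs_le.1 hp
  have hp0 : 0 < p := by linarith
  set η := r / X with hη
  have hη0 : 0 < η := by positivity
  have hη1 : η ≤ 1 / 2 := by rw [hη, div_le_iff₀ hX0]; linarith
  set t := p / X with ht
  have ht1 : |t - 1| ≤ η := by
    rw [ht, hη, div_sub_one hX0.ne', abs_div, abs_of_pos hX0]; gcongr
  have htI : t ∈ Set.Icc (1 / 2 : ℝ) (3 / 2) := by
    obtain ⟨h, h'⟩ := abs_le.1 ht1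
    constructor <;> linarith
  have ht0 : 0 < t := by positivity
  have hpX : p = t * X := by rw [ht]; field_simp
  have hrX : r = η * X := by rw [hη]; field_simp
  have hXρ : 0 < X ^ ρ := by positivity
  set S := X ^ ρ + Y with hS
  have hS0 : 0 < S := by positivity
  set T := (p ^ ρ + Y') / S with hT
  have hPS : p ^ ρ + Y' = T * S := by rw [hT]; field_simp
  -- This is where ρ ≥ 1 enters: a displacement r^ρ in y is then also a relative perturbation of
  -- order r/X.
  have hηρ : η ^ ρ ≤ η := by
    simpa using Real.rpow_le_rpow_of_exponent_ge hη0 (by linarith) hρ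
  have hrρ : r ^ ρ ≤ η * X ^ ρ := by
    rw [hrX, Real.mul_rpow hη0.le hX0.le]; gcongr
  have hpρ : p ^ ρ = t ^ ρ * X ^ ρ := by rw [hpX, Real.mul_rpow ht0.le hX0.le]
  have hT1 : |T - 1| ≤ (C₁ + 1) * η := by
    rw [hT, div_sub_one hS0.ne', abs_div, abs_of_pos hS0, div_le_iff₀ hS0]
    calc |p ^ ρ + Y' - S| = |(t ^ ρ - 1) * X ^ ρ + (Y' - Y)| := by rw [hpρ, hS]; ring_nf
      _ ≤ |t ^ ρ - 1| * X ^ ρ + r ^ ρ := by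
        refine (abs_add_le _ _).trans (add_le_add ?_ hYY)
        rw [abs_mul, abs_of_pos hXρ]
      _ ≤ C₁ * η * X ^ ρ + η * X ^ ρ := by
        gcongr
        exact (h₁ t htI).trans (by gcongr)
      _ = (C₁ + 1) * η * X ^ ρ := by ring
      _ ≤ (C₁ + 1) * η * S := by gcongr; linarith
  -- The lower bound cannot be read off `hT1`, whose right side need not be small. It comes from p ≥
  -- X/2 and p ≥ r: one copy of p^ρ controls X^ρ, a second absorbs the loss r^ρ in Y.
  have hTI : T ∈ Set.Icc ((1 / 2 : ℝ) ^ ρ / 2) (C₁ + 2) := by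
    constructor
    · rw [hT, le_div_iff₀ hS0]
      have hq : (1 / 2 : ℝ) ^ ρ * X ^ ρ ≤ p ^ ρ := by
        rw [← Real.mul_rpow (by norm_num) hX0.le]
        exact Real.rpow_le_rpow (by positivity) (by linarith) (by linarith)
      have hr' : r ^ ρ ≤ p ^ ρ := Real.rpow_le_rpow hr.le (by linarith) (by linarith)
      have hle : (1 / 2 : ℝ) ^ ρ * Y ≤ Y := by
        have : (1 / 2 : ℝ) ^ ρ ≤ 1 := Real.rpow_le_one (by norm_num) (by norm_num) (by linarith)
        nlinarith
      have := (abs_le.1 hYY).1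
      rw [hS]
      linarith
    · have := (abs_le.1 hT1).2
      nlinarith
  have hT0 : 0 < T := by positivity
  have e1 : |t ^ (-a) - 1| ≤ C₂ * η := (h₂ t htI).trans (by gcongr)
  have e2 : |T ^ (-b) - 1| ≤ C₃ * (C₁ + 1) * η :=
    (h₃ T hTI).trans (by rw [mul_assoc]; gcongr)
  rw [hPS, hpX, Real.mul_rpow ht0.le hX0.le, Real.mul_rpow hT0.le hS0.le]
  have hfac : t ^ (-a) * X ^ (-a) * (T ^ (-b) * S ^ (-b)) - X ^ (-a) * S ^ (-b) =
      ((t ^ (-a) - 1) * (T ^ (-b) - 1) + (t ^ (-a) - 1) + (T ^ (-b) - 1)) *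
        (X ^ (-a) * S ^ (-b)) := by ring
  have hpos : 0 ≤ X ^ (-a) * S ^ (-b) := by positivity
  rw [hfac, abs_mul, abs_of_nonneg hpos]
  refine mul_le_mul_of_nonneg_right ?_ hpos
  refine (abs_add_le _ _).trans ((add_le_add_left (abs_add_le _ _) _).trans ?_)
  rw [abs_mul]
  have e3 : |t ^ (-a) - 1| * |T ^ (-b) - 1| ≤ C₂ * (C₃ * (C₁ + 1)) * η := by
    calc _ ≤ (C₂ * η) * (C₃ * (C₁ + 1) * η) := by gcongr
      _ = C₂ * (C₃ * (C₁ + 1)) * η * η := by ring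
      _ ≤ C₂ * (C₃ * (C₁ + 1)) * η * 1 := by gcongr; linarith
      _ = _ := by ring
  linarith

variable {n m : ℕ} {α β ρ : ℝ}

lemma kernel_eq (z : Space n m) : kernel n m α β ρ z =
    ‖z.1‖ ^ (-((n : ℝ) - α)) * (‖z.1‖ ^ ρ + ‖z.2‖) ^ (-((m : ℝ) - β)) := by
  rw [kernel, Real.rpow_neg (by positivity), Real.rpow_neg (by positivity), one_div, one_div,
    Real.inv_rpow (by positivity), Real.inv_rpow (by positivity)]

lemma kernel_nonneg (z : Space n m) : 0 ≤ kernel n m α β ρ z := by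
  rw [kernel_eq]; positivity

@[fun_prop]
lemma measurable_kernel : Measurable (kernel n m α β ρ) := by
  unfold kernel; fun_prop

lemma enorm_kernel (z : Space n m) :
    ‖kernel n m α β ρ z‖ₑ = ENNReal.ofReal (kernel n m α β ρ z) :=
  Real.enorm_of_nonneg (kernel_nonneg z)

/-- The kernel is dominated by a whole range of products of one-factor powers. -/
lemma enorm_kernel_le (hαn : α < n) {θ : ℝ} (hθ : 0 ≤ θ) (hθm : θ < m - β)
    (z : Space n m) : ‖kernel n m α β ρ z‖ₑ ≤
      normPow (n - α + ρ * θ) z.1 * normPow (m - β - θ) z.2 := by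
  -- At x = 0 the convention for real powers makes the kernel 0; at y = 0 the right side is ∞.
  by_cases h1 : z.1 = 0
  · rw [kernel_eq, h1, norm_zero, Real.zero_rpow (by linarith)]
    simp
  by_cases h2 : z.2 = 0
  · have : normPow (m - β - θ) z.2 = ∞ := by
      rw [h2, normPow, enorm_zero, ENNReal.zero_rpow_of_neg (by linarith)]
    rw [this, ENNReal.mul_top]
    · exact le_top
    · have := norm_pos_iff.2 h1
      rw [normPow_of_ne h1, Ne, ENNReal.ofReal_eq_zero, not_le]
      positivity
  have hx := norm_pos_iff.2 h1
  have hy := norm_pos_iff.2 h2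
  rw [enorm_kernel, kernel_eq, normPow_of_ne h1, normPow_of_ne h2,
    ← ENNReal.ofReal_mul (by positivity)]
  refine ENNReal.ofReal_le_ofReal ?_
  -- Of the decay exponent m - β, the part θ is spent on |x|^ρ and the remainder on |y|.
  have hsplit : (‖z.1‖ ^ ρ + ‖z.2‖) ^ (-((m : ℝ) - β)) =
      (‖z.1‖ ^ ρ + ‖z.2‖) ^ (-θ) * (‖z.1‖ ^ ρ + ‖z.2‖) ^ (-((m : ℝ) - β - θ)) := by
    rw [← Real.rpow_add (by positivity)]; ring_nf
  have hsplit2 : ‖z.1‖ ^ (-((n : ℝ) - α + ρ * θ)) =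
      ‖z.1‖ ^ (-((n : ℝ) - α)) * (‖z.1‖ ^ ρ) ^ (-θ) := by
    rw [← Real.rpow_mul hx.le, ← Real.rpow_add hx]; ring_nf
  rw [hsplit, hsplit2, mul_assoc]
  have hρx : 0 < ‖z.1‖ ^ ρ := by positivity
  refine mul_le_mul_of_nonneg_left (mul_le_mul ?_ ?_ (by positivity) (by positivity))
    (by positivity)
  · exact Real.rpow_le_rpow_of_nonpos hρx (by linarith) (by linarith)
  · exact Real.rpow_le_rpow_of_nonpos hy (by linarith) (by linarith)

lemma exists_abs_kernel_sub_le (n m : ℕ) (α β : ℝ) (hρ : 1 ≤ ρ) :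
    ∃ C : ℝ, 0 ≤ C ∧ ∀ (r : ℝ) (z w : Space n m), 0 < r → 2 * r < ‖z.1‖ → ‖w.1‖ ≤ r →
      ‖w.2‖ ≤ r ^ ρ → |kernel n m α β ρ (z - w) - kernel n m α β ρ z| ≤
        C * (r / ‖z.1‖) * kernel n m α β ρ z := by
  obtain ⟨C, hC, h⟩ := exists_abs_profile_sub_le ((n : ℝ) - α) ((m : ℝ) - β) hρ
  refine ⟨C, hC, fun r z w hr hz hw1 hw2 => ?_⟩
  rw [kernel_eq, kernel_eq]
  refine h r ‖z.1‖ ‖(z - w).1‖ ‖z.2‖ ‖(z - w).2‖ hr hz ?_ (norm_nonneg _) (norm_nonneg _) ?_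
  · refine (abs_norm_sub_norm_le _ _).trans ?_
    simpa using hw1
  · refine (abs_norm_sub_norm_le _ _).trans ?_
    simpa using hw2

end Kernel

/-! ### Moments of averages. -/

section Averages

/-- Hölder's inequality against the constant function 1. -/
lemma lintegral_rpow_le_measure_mul {Y : Type*} [MeasurableSpace Y] (ν : Measure Y) {q : ℝ}
    (hq : 1 < q) {g : Y → ℝ≥0∞} (hg : AEMeasurable g ν) :
    (∫⁻ y, g y ∂ν) ^ q ≤ ν Set.univ ^ (q - 1) * ∫⁻ y, g y ^ q ∂ν := by
  have hpq : q.HolderConjugate (q / (q - 1)) := Real.HolderConjugate.conjExponent hq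
  have h := ENNReal.lintegral_mul_le_Lp_mul_Lq ν hpq hg
    (aemeasurable_const (b := (1 : ℝ≥0∞)))
  have hq0 : 0 < q := by linarith
  calc (∫⁻ y, g y ∂ν) ^ q
      ≤ ((∫⁻ y, g y ^ q ∂ν) ^ (1 / q) *
          (∫⁻ _, 1 ^ (q / (q - 1)) ∂ν) ^ (1 / (q / (q - 1)))) ^ q := by
        gcongr
        simpa using h
    _ = _ := by
        rw [ENNReal.mul_rpow_of_nonneg _ _ hq0.le, ← ENNReal.rpow_mul, ← ENNReal.rpow_mul,
          one_div_mul_cancel hq0.ne', ENNReal.rpow_one, mul_comm]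
        congr 1
        simp only [ENNReal.one_rpow, lintegral_const, one_mul, one_div_div]
        congr 1
        field_simp

/-- Minkowski's inequality for an average, in the form: a bound for the `q`-th moments of the
sections of `G` is a bound for the `q`-th moment of the average. -/
lemma setLIntegral_average_rpow_le {X Y : Type*} [MeasurableSpace X] [MeasurableSpace Y]
    (μ : Measure X) (ν : Measure Y) [SFinite μ] [SFinite ν] {q : ℝ} (hq : 1 < q)
    {G : X → Y → ℝ≥0∞} (hG : Measurable (Function.uncurry G)) {F : Set X} {E : Set Y}
    {c V M : ℝ≥0∞} (hV : c * ν E ≤ V)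
    (hM : ∀ w ∈ E, ∫⁻ z in F, G z w ^ q ∂μ ≤ M) :
    ∫⁻ z in F, (c * ∫⁻ w in E, G z w ∂ν) ^ q ∂μ ≤ V ^ q * M := by
  have hq0 : 0 < q := by linarith
  have hGq : Measurable (Function.uncurry fun z w => G z w ^ q) := hG.pow_const q
  have hcpow : ∀ x : ℝ≥0∞, x ^ q = x ^ (q - 1) * x := fun x => by
    nth_rw 3 [← ENNReal.rpow_one x]
    rw [← ENNReal.rpow_add_of_nonneg _ _ (by linarith) zero_le_one, sub_add_cancel]
  calc ∫⁻ z in F, (c * ∫⁻ w in E, G z w ∂ν) ^ q ∂μ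
      ≤ ∫⁻ z in F, V ^ (q - 1) * c * ∫⁻ w in E, G z w ^ q ∂ν ∂μ := by
        refine lintegral_mono fun z => ?_
        rw [ENNReal.mul_rpow_of_nonneg _ _ hq0.le]
        have hz : Measurable (G z) := hG.of_uncurry_left
        calc c ^ q * (∫⁻ w in E, G z w ∂ν) ^ q
            ≤ c ^ q * (ν E ^ (q - 1) * ∫⁻ w in E, G z w ^ q ∂ν) := by
              gcongr
              simpa using lintegral_rpow_le_measure_mul (ν.restrict E) hq hz.aemeasurable
          _ = (c * ν E) ^ (q - 1) * c * ∫⁻ w in E, G z w ^ q ∂ν := by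
              rw [hcpow c, ENNReal.mul_rpow_of_nonneg _ _ (by linarith)]; ring
          _ ≤ _ := by gcongr
    _ = V ^ (q - 1) * c * ∫⁻ w in E, ∫⁻ z in F, G z w ^ q ∂μ ∂ν := by
        rw [lintegral_const_mul, lintegral_lintegral_swap hGq.aemeasurable]
        exact hGq.lintegral_prod_right'
    _ ≤ V ^ (q - 1) * c * ∫⁻ _ in E, M ∂ν := by
        refine mul_le_mul_right ?_ _
        exact setLIntegral_mono measurable_const hM
    _ = V ^ (q - 1) * (c * ν E) * M := by rw [setLIntegral_const]; ring
    _ ≤ V ^ (q - 1) * V * M := by gcongr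
    _ = V ^ q * M := by rw [← hcpow]

lemma setLIntegral_closedBall_comp_sub {E : Type*} [NormedAddCommGroup E] [MeasurableSpace E]
    [BorelSpace E] (μ : Measure E) [μ.IsAddHaarMeasure] {g : E → ℝ≥0∞} (c u : E) (R : ℝ) :
    ∫⁻ x in Metric.closedBall c R, g (x - u) ∂μ = ∫⁻ x in Metric.closedBall (c - u) R, g x ∂μ := by
  rw [← lintegral_indicator Metric.isClosed_closedBall.measurableSet,
    ← lintegral_indicator Metric.isClosed_closedBall.measurableSet,
    ← lintegral_sub_right_eq_self ((Metric.closedBall (c - u) R).indicator g) u]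
  refine lintegral_congr fun x => ?_
  classical
  simp only [Set.indicator_apply, Metric.mem_closedBall, dist_sub_right]

variable {E : Type*} [NormedAddCommGroup E] [NormedSpace ℝ E] [MeasurableSpace E] [BorelSpace E]
  [FiniteDimensional ℝ E] (μ : Measure E) [μ.IsAddHaarMeasure]

lemma setLIntegral_closedBall_normPow_sub_comm (a : ℝ) (x c : E) (R : ℝ) :
    ∫⁻ u in Metric.closedBall c R, normPow a (x - u) ∂μ =
      ∫⁻ u in Metric.closedBall (c - x) R, normPow a u ∂μ := by
  rw [← setLIntegral_closedBall_comp_sub]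
  refine lintegral_congr fun u => ?_
  rw [← normPow_neg, neg_sub]

local notation "dim" => (Module.finrank ℝ E : ℝ)

/-- The average of `normPow a (x - ·)` over the ball of radius `s`, up to a constant factor. -/
noncomputable def ballAverage (a s : ℝ) (x : E) : ℝ≥0∞ :=
  ENNReal.ofReal (s ^ (-dim)) * ∫⁻ u in Metric.closedBall (0 : E) s, normPow a (x - u) ∂μ

/-- Only local integrability of the power is needed, since the average is bounded pointwise by a
multiple of s^(-a). The price is a bound depending on s. -/
lemma exists_setLIntegral_ballAverage_rpow_le_radius [Nontrivial E] {a q : ℝ} (ha : 0 ≤ a)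
    (han : a < dim) (hq : 1 < q) : ∃ C : ℝ≥0, ∀ s R : ℝ, 0 < s → 0 < R →
      ∫⁻ x in Metric.closedBall (0 : E) R, ballAverage μ a s x ^ q ∂μ ≤
        C * ENNReal.ofReal (s ^ (-(q * a)) * R ^ dim) := by
  obtain ⟨C, hC⟩ := exists_setLIntegral_closedBall_normPow_le μ ha han
  refine ⟨C ^ q * (μ (Metric.closedBall (0 : E) 1)).toNNReal, fun s R hs hR => ?_⟩
  have hpt : ∀ x : E, ballAverage μ a s x ^ q ≤
      (C : ℝ≥0∞) ^ q * ENNReal.ofReal (s ^ (-(q * a))) := by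
    intro x
    have h1 : ballAverage μ a s x ≤ C * ENNReal.ofReal (s ^ (-a)) := by
      rw [ballAverage, setLIntegral_closedBall_normPow_sub_comm]
      calc _ ≤ ENNReal.ofReal (s ^ (-dim)) * (C * ENNReal.ofReal (s ^ (dim - a))) := by
            gcongr; exact hC s hs _
        _ = C * ENNReal.ofReal (s ^ (-dim) * s ^ (dim - a)) := by
            rw [ENNReal.ofReal_mul (by positivity)]; ring
        _ = _ := by rw [← Real.rpow_add hs]; ring_nf
    calc ballAverage μ a s x ^ q ≤ (C * ENNReal.ofReal (s ^ (-a))) ^ q := by gcongr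
      _ = _ := by
        rw [ENNReal.mul_rpow_of_nonneg _ _ (by linarith),
          ENNReal.ofReal_rpow_of_pos (by positivity), ← Real.rpow_mul hs.le]
        ring_nf
  calc ∫⁻ x in Metric.closedBall (0 : E) R, ballAverage μ a s x ^ q ∂μ
      ≤ ∫⁻ _ in Metric.closedBall (0 : E) R, (C : ℝ≥0∞) ^ q * ENNReal.ofReal (s ^ (-(q * a))) ∂μ :=
        lintegral_mono fun x => hpt x
    _ = _ := by
        rw [setLIntegral_const, Measure.addHaar_closedBall' μ _ hR.le,
          ENNReal.ofReal_mul (by positivity), Real.rpow_natCast, ENNReal.coe_mul,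
          ENNReal.coe_toNNReal measure_closedBall_lt_top.ne,
          ENNReal.coe_rpow_of_nonneg _ (by linarith)]
        ring

/-- Counterpart of the pointwise estimate: when the q-th power is itself locally integrable,
Minkowski's inequality gives a bound free of s. -/
lemma exists_setLIntegral_ballAverage_rpow_le [Nontrivial E] {a q : ℝ} (ha : 0 ≤ a)
    (hq : 1 < q) (han : q * a < dim) : ∃ C : ℝ≥0, ∀ s R : ℝ, 0 < s → 0 < R →
      ∫⁻ x in Metric.closedBall (0 : E) R, ballAverage μ a s x ^ q ∂μ ≤
        C * ENNReal.ofReal (R ^ (dim - q * a)) := by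
  obtain ⟨C, hC⟩ := exists_setLIntegral_closedBall_normPow_le μ (by positivity) han
  refine ⟨(μ (Metric.closedBall (0 : E) 1)).toNNReal ^ q * C, fun s R hs hR => ?_⟩
  rw [ENNReal.coe_mul, mul_assoc, ENNReal.coe_rpow_of_nonneg _ (by linarith)]
  refine setLIntegral_average_rpow_le μ μ hq (G := fun x u => normPow a (x - u))
    ((measurable_normPow a).comp measurable_sub) ?_ ?_
  · rw [Measure.addHaar_closedBall' μ _ hs.le, ← mul_assoc, ← ENNReal.ofReal_mul (by positivity),
      ← Real.rpow_natCast, ← Real.rpow_add hs, ENNReal.coe_toNNReal measure_closedBall_lt_top.ne]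
    simp
  · intro u _
    simp_rw [normPow_rpow]
    rw [setLIntegral_closedBall_comp_sub]
    exact hC R hR _

end Averages

/-! ### Local integrability and almost everywhere convergence. -/

section LocalIntegrability

variable {n m : ℕ} {α β ρ : ℝ}

/-- The product of the closed balls of radii `R` and `S` about the origin. -/
def box (n m : ℕ) (R S : ℝ) : Set (Space n m) :=
  Metric.closedBall 0 R ×ˢ Metric.closedBall 0 S

lemma measurableSet_box (R S : ℝ) : MeasurableSet (box n m R S) :=
  Metric.isClosed_closedBall.measurableSet.prod Metric.isClosed_closedBall.measurableSet

lemma setLIntegral_prod_mul {X Y : Type*} [MeasurableSpace X] [MeasurableSpace Y] (μ : Measure X)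
    (ν : Measure Y) [SFinite μ] [SFinite ν] (A : Set X) (B : Set Y) {f : X → ℝ≥0∞} {g : Y → ℝ≥0∞}
    (hf : Measurable f) (hg : Measurable g) :
    ∫⁻ z in A ×ˢ B, f z.1 * g z.2 ∂(μ.prod ν) = (∫⁻ x in A, f x ∂μ) * ∫⁻ y in B, g y ∂ν := by
  rw [← Measure.prod_restrict, lintegral_prod_mul hf.aemeasurable hg.aemeasurable]

lemma exists_setLIntegral_box_enorm_kernel_le [NeZero n] [NeZero m] (hα : 0 < α) (hαn : α < n)
    (hβ : 0 < β) (hβm : β < m) {R : ℝ} (hR : 0 < R) :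
    ∃ C : ℝ≥0, ∀ w : Space n m, ∫⁻ z in box n m R R, ‖kernel n m α β ρ (z - w)‖ₑ ≤ C := by
  obtain ⟨C₁, h₁⟩ := exists_setLIntegral_closedBall_normPow_le
    (volume : Measure (EuclideanSpace ℝ (Fin n))) (a := n - α) (by linarith) (by simpa using hα)
  obtain ⟨C₂, h₂⟩ := exists_setLIntegral_closedBall_normPow_le
    (volume : Measure (EuclideanSpace ℝ (Fin m))) (a := m - β) (by linarith) (by simpa using hβ)
  refine ⟨(C₁ * (R ^ ((Module.finrank ℝ (EuclideanSpace ℝ (Fin n)) : ℝ) - (n - α))).toNNReal) *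
    (C₂ * (R ^ ((Module.finrank ℝ (EuclideanSpace ℝ (Fin m)) : ℝ) - (m - β))).toNNReal),
    fun w => ?_⟩
  calc ∫⁻ z in box n m R R, ‖kernel n m α β ρ (z - w)‖ₑ
      ≤ ∫⁻ z in box n m R R, normPow (n - α) (z.1 - w.1) * normPow (m - β) (z.2 - w.2) := by
        refine lintegral_mono fun z => ?_
        simpa using enorm_kernel_le (β := β) (m := m) hαn le_rfl (by linarith) (z - w)
    _ = (∫⁻ x in Metric.closedBall (0 : EuclideanSpace ℝ (Fin n)) R, normPow (n - α) (x - w.1)) *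
        ∫⁻ y in Metric.closedBall (0 : EuclideanSpace ℝ (Fin m)) R, normPow (m - β) (y - w.2) :=
        setLIntegral_prod_mul _ _ _ _
          ((measurable_normPow _).comp (measurable_id.sub_const _))
          ((measurable_normPow _).comp (measurable_id.sub_const _))
    _ ≤ _ := by
        rw [setLIntegral_closedBall_comp_sub, setLIntegral_closedBall_comp_sub]
        push_cast
        gcongr
        · exact h₁ R hR _
        · exact h₂ R hR _

lemma exists_setLIntegral_box_lintegral_enorm_le [NeZero n] [NeZero m] (hα : 0 < α) (hαn : α < n)
    (hβ : 0 < β) (hβm : β < m) {R : ℝ} (hR : 0 < R) :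
    ∃ C : ℝ≥0, ∀ g : Space n m → ℝ≥0∞, AEMeasurable g →
      ∫⁻ z in box n m R R, ∫⁻ w, ‖kernel n m α β ρ (z - w)‖ₑ * g w ≤ C * ∫⁻ w, g w := by
  obtain ⟨C, hC⟩ := exists_setLIntegral_box_enorm_kernel_le hα hαn hβ hβm hR
  refine ⟨C, fun g hg => ?_⟩
  rw [lintegral_lintegral_swap]
  · calc ∫⁻ w, ∫⁻ z in box n m R R, ‖kernel n m α β ρ (z - w)‖ₑ * g w
        = ∫⁻ w, (∫⁻ z in box n m R R, ‖kernel n m α β ρ (z - w)‖ₑ) * g w := by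
          refine lintegral_congr fun w => ?_
          rw [lintegral_mul_const]
          exact (measurable_kernel.comp (measurable_id.sub_const w)).enorm
      _ ≤ ∫⁻ w, C * g w := by
          gcongr with w
          exact hC w
      _ = C * ∫⁻ w, g w := lintegral_const_mul' _ _ ENNReal.coe_ne_top
  · exact (measurable_kernel.comp measurable_sub).enorm.aemeasurable.mul hg.comp_snd

lemma ae_of_forall_ae_restrict_box {P : Space n m → Prop}
    (h : ∀ N : ℕ, ∀ᵐ z ∂(volume.restrict (box n m (N + 1) (N + 1))), P z) : ∀ᵐ z, P z := by
  have hU : (⋃ N : ℕ, box n m (N + 1) (N + 1)) = Set.univ := by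
    refine Set.eq_univ_of_forall fun z => ?_
    obtain ⟨N, hN⟩ := exists_nat_ge (max ‖z.1‖ ‖z.2‖)
    refine Set.mem_iUnion.2 ⟨N, ?_⟩
    have h1 := (le_max_left _ _).trans hN
    have h2 := (le_max_right _ _).trans hN
    simp only [box, Set.mem_prod, Metric.mem_closedBall, dist_zero_right]
    constructor <;> linarith
  rw [← Measure.restrict_univ (μ := (volume : Measure (Space n m))), ← hU, ae_restrict_iUnion_iff]
  exact h

variable {𝕜 : Type*} [RCLike 𝕜]

lemma aestronglyMeasurable_kernel_smul {f : Space n m → 𝕜} (hf : AEStronglyMeasurable f) :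
    AEStronglyMeasurable (fun p : Space n m × Space n m => kernel n m α β ρ (p.1 - p.2) • f p.2)
      (volume.prod volume) :=
  (measurable_kernel.comp measurable_sub).aestronglyMeasurable.smul hf.comp_snd

lemma aestronglyMeasurable_fracIntegral {f : Space n m → 𝕜} (hf : AEStronglyMeasurable f) :
    AEStronglyMeasurable (fracIntegral n m α β ρ f) :=
  (aestronglyMeasurable_kernel_smul hf).integral_prod_right'

/-- By Tonelli and the uniform integrability of the kernel over translates of a box, the integral of
|Ω(z-w)||f(w)| in w is itself integrable in z over each box, hence finite almost everywhere. -/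
lemma ae_integrable_kernel_smul [NeZero n] [NeZero m] (hα : 0 < α) (hαn : α < n)
    (hβ : 0 < β) (hβm : β < m) {f : Space n m → 𝕜} (hf : Integrable f) :
    ∀ᵐ z, Integrable (fun w => kernel n m α β ρ (z - w) • f w) := by
  refine ae_of_forall_ae_restrict_box fun N => ?_
  obtain ⟨C, hC⟩ := exists_setLIntegral_box_lintegral_enorm_le hα hαn hβ hβm
    (R := (N : ℝ) + 1) (by positivity)
  have hfin := (hC (fun w => ‖f w‖ₑ) hf.1.enorm).trans_lt
    (ENNReal.mul_lt_top ENNReal.coe_lt_top hf.2)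
  have hmeas : AEMeasurable (fun p : Space n m × Space n m =>
      ‖kernel n m α β ρ (p.1 - p.2)‖ₑ * ‖f p.2‖ₑ) (volume.prod volume) :=
    (measurable_kernel.comp measurable_sub).enorm.aemeasurable.mul hf.1.comp_snd.enorm
  filter_upwards [ae_lt_top' hmeas.lintegral_prod_right'.restrict hfin.ne] with z hz
  refine ⟨((measurable_kernel.comp (measurable_const.sub measurable_id)).aestronglyMeasurable).smul
    hf.1, ?_⟩
  simpa [HasFiniteIntegral, enorm_smul] using hz

lemma enorm_fracIntegral_le (f : Space n m → 𝕜) (z : Space n m) :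
    ‖fracIntegral n m α β ρ f z‖ₑ ≤ ∫⁻ w, ‖kernel n m α β ρ (z - w)‖ₑ * ‖f w‖ₑ := by
  refine (enorm_integral_le_lintegral_enorm _).trans_eq ?_
  simp [enorm_smul]

end LocalIntegrability

/-! ### Scale-invariant estimates on the three regions. -/

section UniformBounds

variable {n m : ℕ} {α β ρ q : ℝ}

lemma volume_box (s : ℝ) (hs : 0 ≤ s) : volume (box n m s s) =
    ENNReal.ofReal (s ^ ((n : ℝ) + m)) * volume (box n m 1 1) := by
  rw [box, box, Measure.volume_eq_prod, Measure.prod_prod, Measure.prod_prod,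
    Measure.addHaar_closedBall' _ _ hs, Measure.addHaar_closedBall' _ _ hs,
    finrank_euclideanSpace_fin, finrank_euclideanSpace_fin, ← Nat.cast_add, Real.rpow_natCast,
    pow_add, ENNReal.ofReal_mul (by positivity)]
  ring

lemma volume_box_ne_top (R S : ℝ) : volume (box n m R S) ≠ ∞ := by
  rw [box, Measure.volume_eq_prod, Measure.prod_prod]
  exact (ENNReal.mul_lt_top measure_closedBall_lt_top measure_closedBall_lt_top).ne

lemma toReal_volume_box_one_pos (n m : ℕ) : 0 < (volume (box n m 1 1)).toReal := by
  refine ENNReal.toReal_pos ?_ (volume_box_ne_top 1 1)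
  rw [box, Measure.volume_eq_prod, Measure.prod_prod]
  exact mul_ne_zero (Metric.measure_closedBall_pos _ _ one_pos).ne'
    (Metric.measure_closedBall_pos _ _ one_pos).ne'

lemma ofReal_rpow_neg_mul_volume_box {s : ℝ} (hs : 0 < s) :
    ENNReal.ofReal (s ^ (-((n : ℝ) + m))) * volume (box n m s s) = volume (box n m 1 1) := by
  rw [volume_box s hs.le, ← mul_assoc, ← ENNReal.ofReal_mul (by positivity), ← Real.rpow_add hs]
  simp

/-- The average of `|kernel (z - ·)|` over a box of side `s`, up to a constant factor. -/
noncomputable def boxAverage (n m : ℕ) (α β ρ s : ℝ) (z : Space n m) : ℝ≥0∞ :=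
  ENNReal.ofReal (s ^ (-((n : ℝ) + m))) * ∫⁻ w in box n m s s, ‖kernel n m α β ρ (z - w)‖ₑ

lemma boxAverage_le (hαn : α < n) {θ : ℝ} (hθ : 0 ≤ θ) (hθm : θ < m - β) {s : ℝ} (hs : 0 < s)
    (z : Space n m) : boxAverage n m α β ρ s z ≤
      ballAverage volume (n - α + ρ * θ) s z.1 * ballAverage volume (m - β - θ) s z.2 := by
  calc boxAverage n m α β ρ s z
      ≤ ENNReal.ofReal (s ^ (-((n : ℝ) + m))) * ∫⁻ w in box n m s s,
          normPow (n - α + ρ * θ) (z.1 - w.1) * normPow (m - β - θ) (z.2 - w.2) := by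
        unfold boxAverage
        gcongr with w
        exact enorm_kernel_le hαn hθ hθm (z - w)
    _ = ENNReal.ofReal (s ^ (-((n : ℝ) + m))) *
          ((∫⁻ u in Metric.closedBall (0 : EuclideanSpace ℝ (Fin n)) s,
              normPow (n - α + ρ * θ) (z.1 - u)) *
            ∫⁻ v in Metric.closedBall (0 : EuclideanSpace ℝ (Fin m)) s,
              normPow (m - β - θ) (z.2 - v)) := by
        congr 1
        exact setLIntegral_prod_mul _ _ _ _
          ((measurable_normPow _).comp (measurable_id.const_sub _))
          ((measurable_normPow _).comp (measurable_id.const_sub _))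
    _ = _ := by
        rw [ballAverage, ballAverage, finrank_euclideanSpace_fin, finrank_euclideanSpace_fin,
          neg_add, Real.rpow_add hs, ENNReal.ofReal_mul (by positivity)]
        ring

lemma measurable_ballAverage {E : Type*} [NormedAddCommGroup E] [NormedSpace ℝ E]
    [MeasurableSpace E] [BorelSpace E] [FiniteDimensional ℝ E] (μ : Measure E)
    [μ.IsAddHaarMeasure] (a s : ℝ) : Measurable (ballAverage μ a s) := by
  have : Measurable (Function.uncurry fun x u : E => normPow a (x - u)) :=
    (measurable_normPow a).comp measurable_sub
  exact this.lintegral_prod_right'.const_mul _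

lemma setLIntegral_boxAverage_rpow_le (hαn : α < n) {θ : ℝ} (hθ : 0 ≤ θ) (hθm : θ < m - β)
    {s : ℝ} (hs : 0 < s) (hq : 1 < q) (R S : ℝ) :
    ∫⁻ z in box n m R S, boxAverage n m α β ρ s z ^ q ≤
      (∫⁻ x in Metric.closedBall (0 : EuclideanSpace ℝ (Fin n)) R,
        ballAverage volume (n - α + ρ * θ) s x ^ q) *
      ∫⁻ y in Metric.closedBall (0 : EuclideanSpace ℝ (Fin m)) S,
        ballAverage volume (m - β - θ) s y ^ q := by
  calc ∫⁻ z in box n m R S, boxAverage n m α β ρ s z ^ q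
      ≤ ∫⁻ z in box n m R S, ballAverage volume (n - α + ρ * θ) s z.1 ^ q *
          ballAverage volume (m - β - θ) s z.2 ^ q := by
        refine lintegral_mono fun z => ?_
        rw [← ENNReal.mul_rpow_of_nonneg _ _ (by linarith)]
        gcongr
        exact boxAverage_le hαn hθ hθm hs z
    _ = _ := setLIntegral_prod_mul _ _ _ _ ((measurable_ballAverage _ _ _).pow_const q)
        ((measurable_ballAverage _ _ _).pow_const q)

/-- The averaged kernel is at most a product of ball averages in x and y. If s = r, the pointwise
bound is used in x and the L^q bound in y; if s = r^ρ, the roles are exchanged with θ = 0. In both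
cases homogeneity cancels every power of r. -/
lemma exists_setLIntegral_near_le [NeZero n] [NeZero m] (hαn : α < n) (hα : 0 < α)
    (hβ : 0 < β) (hβm : β < m) (hρ : 1 ≤ ρ) (hq : 1 < q) (hqα : q * (n - α) < n)
    (hhom : n - q * (n - α) + ρ * (m - q * (m - β)) = 0) :
    ∃ C : ℝ≥0, ∀ s r : ℝ, 0 < s → 0 < r → (s = r ∨ s = r ^ ρ) →
      ∫⁻ z in box n m (2 * r) (2 * r ^ ρ), boxAverage n m α β ρ s z ^ q ≤ C := by
  have hρ0 : 0 < ρ := by linarith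
  have hq0 : 0 < q := by linarith
  obtain ⟨θ, hθ0, hθm, hθα, hθq⟩ : ∃ θ : ℝ, 0 ≤ θ ∧ θ < m - β ∧ ρ * θ < α ∧
      q * (m - β - θ) < m := by
    -- The condition q(m-β-θ) < m means θ > δ. Homogeneity gives qρδ = n - q(n-α), which is positive
    -- by `hqα` and less than qα because q > 1, so there is room for θ between δ and α/ρ.
    set δ : ℝ := m - β - m / q with hδ
    have hqδ : q * δ = q * (m - β) - m := by rw [hδ]; field_simp
    have hδρ : q * (ρ * δ) = n - q * (n - α) := by linear_combination ρ * hqδ - hhom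
    have hδ0 : 0 < δ := by
      have : 0 < q * (ρ * δ) := by rw [hδρ]; linarith
      have := pos_of_mul_pos_right this hq0.le
      exact pos_of_mul_pos_right this hρ0.le
    have hδα : δ < α / ρ := by
      rw [lt_div_iff₀ hρ0]
      have hn : (0 : ℝ) < n := by linarith
      nlinarith
    have hm0 : (0 : ℝ) < m := by linarith
    have hδm : δ < m - β := by have : 0 < m / q := by positivity
                               linarith
    obtain ⟨θ, h1, h2⟩ := exists_between (lt_min hδα hδm)
    refine ⟨θ, by linarith, h2.trans_le (min_le_right _ _), ?_, ?_⟩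
    · have := h2.trans_le (min_le_left _ _)
      rw [lt_div_iff₀ hρ0] at this
      linarith
    · nlinarith
  obtain ⟨A₁, hA₁⟩ := exists_setLIntegral_ballAverage_rpow_le
    (volume : Measure (EuclideanSpace ℝ (Fin n))) (a := n - α + ρ * 0) (by linarith) hq
    (by simpa using hqα)
  obtain ⟨A₂, hA₂⟩ := exists_setLIntegral_ballAverage_rpow_le_radius
    (volume : Measure (EuclideanSpace ℝ (Fin m))) (a := m - β - 0) (q := q) (by linarith)
    (by simpa using hβ) hq
  obtain ⟨B₁, hB₁⟩ := exists_setLIntegral_ballAverage_rpow_le_radius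
    (volume : Measure (EuclideanSpace ℝ (Fin n))) (a := n - α + ρ * θ) (q := q)
    (by nlinarith) (by simp; linarith) hq
  obtain ⟨B₂, hB₂⟩ := exists_setLIntegral_ballAverage_rpow_le
    (volume : Measure (EuclideanSpace ℝ (Fin m))) (a := m - β - θ) (by linarith) hq
    (by simpa using hθq)
  simp only [finrank_euclideanSpace_fin] at hA₁ hA₂ hB₁ hB₂
  refine ⟨B₁ * B₂ * ((2 : ℝ) ^ (n : ℝ) * 2 ^ (m - q * (m - β - θ))).toNNReal +
    A₁ * A₂ * ((2 : ℝ) ^ (n - q * (n - α + ρ * 0)) * 2 ^ (m : ℝ)).toNNReal,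
    fun s r hs hr hsr => ?_⟩
  have hrρ : 0 < r ^ ρ := by positivity
  have key : ∀ (A B : ℝ≥0) (X Y c : ℝ), 0 ≤ X → X * Y = c →
      (A : ℝ≥0∞) * ENNReal.ofReal X * (B * ENNReal.ofReal Y) = (A * B * c.toNNReal : ℝ≥0) := by
    intro A B X Y c hX h
    rw [← h, ENNReal.coe_mul, ENNReal.coe_mul, ← ENNReal.ofReal, ENNReal.ofReal_mul hX]
    ring
  rcases hsr with h | h
  · refine (setLIntegral_boxAverage_rpow_le hαn hθ0 hθm hs hq _ _).trans
      ((mul_le_mul' (hB₁ s (2 * r) hs (by positivity))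
        (hB₂ s (2 * r ^ ρ) hs (by positivity))).trans ?_)
    rw [key _ _ _ _ ((2 : ℝ) ^ (n : ℝ) * 2 ^ (m - q * (m - β - θ))) (by positivity)]
    · exact ENNReal.coe_le_coe.2 le_self_add
    · rw [h, Real.mul_rpow two_pos.le hr.le, Real.mul_rpow two_pos.le hrρ.le, ← Real.rpow_mul hr.le]
      have : r ^ (-(q * ((n : ℝ) - α + ρ * θ))) * r ^ (n : ℝ) * r ^ (ρ * (m - q * (m - β - θ)))
          = 1 := by
        rw [← Real.rpow_add hr, ← Real.rpow_add hr, ← Real.rpow_zero r]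
        congr 1
        linear_combination hhom
      linear_combination ((2 : ℝ) ^ (n : ℝ) * 2 ^ (m - q * (m - β - θ))) * this
  · refine (setLIntegral_boxAverage_rpow_le hαn le_rfl (by linarith) hs hq _ _).trans
      ((mul_le_mul' (hA₁ s (2 * r) hs (by positivity))
        (hA₂ s (2 * r ^ ρ) hs (by positivity))).trans ?_)
    rw [key _ _ _ _ ((2 : ℝ) ^ (n - q * (n - α + ρ * 0)) * 2 ^ (m : ℝ)) (by positivity)]
    · exact ENNReal.coe_le_coe.2 le_add_self
    · rw [h, Real.mul_rpow two_pos.le hr.le, Real.mul_rpow two_pos.le hrρ.le, ← Real.rpow_mul hr.le,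
        ← Real.rpow_mul hr.le]
      have : r ^ ((n : ℝ) - q * (n - α + ρ * 0)) * r ^ (ρ * -(q * (m - β - 0))) * r ^ (ρ * (m : ℝ))
          = 1 := by
        rw [← Real.rpow_add hr, ← Real.rpow_add hr, ← Real.rpow_zero r]
        congr 1
        linear_combination hhom
      linear_combination ((2 : ℝ) ^ (n - q * (n - α + ρ * 0)) * 2 ^ (m : ℝ)) * this

lemma measurable_uncurry_kernel_sub :
    Measurable (Function.uncurry fun z w : Space n m => ‖kernel n m α β ρ (z - w)‖ₑ) :=
  (measurable_kernel.comp measurable_sub).enorm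

lemma exists_setLIntegral_farSnd_le [NeZero n] [NeZero m] (hαn : α < n)
    (hβm : β < m) (hq : 1 < q) (hqα : q * (n - α) < n) (hqβ : m < q * (m - β))
    (hhom : n - q * (n - α) + ρ * (m - q * (m - β)) = 0) :
    ∃ C : ℝ≥0, ∀ s r : ℝ, 0 < s → 0 < r → s ≤ r ^ ρ →
      ∫⁻ z in Metric.closedBall 0 (2 * r) ×ˢ {y | 2 * r ^ ρ ≤ ‖y‖},
        boxAverage n m α β ρ s z ^ q ≤ C := by
  have hq0 : 0 < q := by linarith
  obtain ⟨A, hA⟩ := exists_setLIntegral_closedBall_normPow_le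
    (volume : Measure (EuclideanSpace ℝ (Fin n))) (a := q * (n - α))
    (mul_nonneg hq0.le (by linarith)) (by simpa using hqα)
  obtain ⟨B, hB⟩ := exists_setLIntegral_norm_ge_normPow_le
    (volume : Measure (EuclideanSpace ℝ (Fin m))) (a := q * (m - β)) (by simpa using hqβ)
  simp only [finrank_euclideanSpace_fin] at hA hB
  refine ⟨(volume (box n m 1 1)).toNNReal ^ q * (A * B * ((2 : ℝ) ^ (n - q * (n - α))).toNNReal),
    fun s r hs hr hsr => ?_⟩
  have hrρ : 0 < r ^ ρ := by positivity
  rw [ENNReal.coe_mul, ENNReal.coe_rpow_of_nonneg _ hq0.le,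
    ENNReal.coe_toNNReal (volume_box_ne_top 1 1)]
  refine setLIntegral_average_rpow_le volume volume hq measurable_uncurry_kernel_sub
    (ofReal_rpow_neg_mul_volume_box hs).le fun w hw => ?_
  calc ∫⁻ z in Metric.closedBall 0 (2 * r) ×ˢ {y | 2 * r ^ ρ ≤ ‖y‖},
        ‖kernel n m α β ρ (z - w)‖ₑ ^ q
      ≤ ∫⁻ z in Metric.closedBall 0 (2 * r) ×ˢ {y | 2 * r ^ ρ ≤ ‖y‖},
        normPow (q * (n - α)) (z.1 - w.1) * normPow (q * (m - β)) (z.2 - w.2) := by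
        refine lintegral_mono fun z => ?_
        rw [← normPow_rpow, ← normPow_rpow, ← ENNReal.mul_rpow_of_nonneg _ _ hq0.le]
        gcongr
        simpa using enorm_kernel_le (ρ := ρ) (β := β) (m := m) hαn le_rfl (by linarith) (z - w)
    _ = (∫⁻ x in Metric.closedBall 0 (2 * r), normPow (q * (n - α)) (x - w.1)) *
        ∫⁻ y in {y | 2 * r ^ ρ ≤ ‖y‖}, normPow (q * (m - β)) (y - w.2) :=
        setLIntegral_prod_mul _ _ _ _
          ((measurable_normPow _).comp (measurable_id.sub_const _))
          ((measurable_normPow _).comp (measurable_id.sub_const _))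
    _ ≤ (A * ENNReal.ofReal ((2 * r) ^ (n - q * (n - α)))) *
        (B * ENNReal.ofReal ((r ^ ρ) ^ (m - q * (m - β)))) := by
        gcongr
        · rw [setLIntegral_closedBall_comp_sub]
          exact hA _ (by positivity) _
        -- Since |w.2| ≤ s ≤ r^ρ, translation by w.2 keeps the region |y| ≥ 2r^ρ inside |y| ≥ r^ρ.
        · refine le_trans ?_ (hB _ hrρ)
          rw [← lintegral_indicator (measurableSet_le measurable_const measurable_norm),
            ← lintegral_indicator (measurableSet_le measurable_const measurable_norm),
            ← lintegral_sub_right_eq_self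
              ({y : EuclideanSpace ℝ (Fin m) | r ^ ρ ≤ ‖y‖}.indicator _) w.2]
          refine lintegral_mono fun y => ?_
          have hw2 : ‖w.2‖ ≤ s := by simpa using hw.2
          by_cases hy : y ∈ {y : EuclideanSpace ℝ (Fin m) | 2 * r ^ ρ ≤ ‖y‖}
          swap
          · rw [Set.indicator_of_notMem hy]; exact bot_le
          rw [Set.indicator_of_mem hy]
          have hy : 2 * r ^ ρ ≤ ‖y‖ := hy
          rw [Set.indicator_of_mem]
          have := norm_sub_norm_le y w.2
          show r ^ ρ ≤ ‖y - w.2‖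
          linarith
    _ = A * B * ENNReal.ofReal ((2 * r) ^ (n - q * (n - α)) * (r ^ ρ) ^ (m - q * (m - β))) := by
        rw [ENNReal.ofReal_mul (by positivity)]; ring
    _ = _ := by
        rw [Real.mul_rpow two_pos.le hr.le, ← Real.rpow_mul hr.le, mul_assoc (_ ^ _),
          ← Real.rpow_add hr, hhom, Real.rpow_zero, mul_one]
        push_cast
        rfl

/-- Replacing the kernel by its difference gains r/|x|. After y is integrated out, homogeneity
leaves r^q |x|^(-n-q), whose integral over |x| > 2r is bounded independently of r. -/
lemma exists_setLIntegral_farFst_le [NeZero n] (hρ : 1 ≤ ρ)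
    (hq : 1 < q) (hqβ : m < q * (m - β))
    (hhom : n - q * (n - α) + ρ * (m - q * (m - β)) = 0) :
    ∃ C : ℝ≥0, ∀ s r : ℝ, 0 < s → 0 < r → s ≤ r → s ≤ r ^ ρ →
      ∫⁻ z in {z : Space n m | 2 * r < ‖z.1‖}, (ENNReal.ofReal (s ^ (-((n : ℝ) + m))) *
        ∫⁻ w in box n m s s, ‖kernel n m α β ρ (z - w) - kernel n m α β ρ z‖ₑ) ^ q ≤ C := by
  have hq0 : 0 < q := by linarith
  obtain ⟨K, hK, hker⟩ := exists_abs_kernel_sub_le n m α β hρ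
  obtain ⟨A, hA⟩ := exists_lintegral_add_norm_rpow_le
    (volume : Measure (EuclideanSpace ℝ (Fin m))) (b := q * (m - β)) (by simpa using hqβ)
  obtain ⟨B, hB⟩ := exists_setLIntegral_norm_ge_normPow_le
    (volume : Measure (EuclideanSpace ℝ (Fin n))) (a := n + q)
    (by simpa using hq0)
  simp only [finrank_euclideanSpace_fin] at hA hB
  refine ⟨(volume (box n m 1 1)).toNNReal ^ q * (A * B * (K ^ q * 2 ^ (-q)).toNNReal),
    fun s r hs hr hsr hsrρ => ?_⟩
  rw [ENNReal.coe_mul, ENNReal.coe_rpow_of_nonneg _ hq0.le,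
    ENNReal.coe_toNNReal (volume_box_ne_top 1 1)]
  refine setLIntegral_average_rpow_le volume volume hq
    (((measurable_kernel.comp measurable_sub).sub (measurable_kernel.comp measurable_fst)).enorm)
    (ofReal_rpow_neg_mul_volume_box hs).le fun w hw => ?_
  have hset : {z : Space n m | 2 * r < ‖z.1‖} =
      {x : EuclideanSpace ℝ (Fin n) | 2 * r < ‖x‖} ×ˢ Set.univ := by
    ext z; simp
  have hmeas : MeasurableSet {x : EuclideanSpace ℝ (Fin n) | 2 * r < ‖x‖} :=
    measurableSet_lt measurable_const measurable_norm
  have hmG : Measurable fun z : Space n m =>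
      ENNReal.ofReal ((K * r) ^ q * ‖z.1‖ ^ (-q - q * (n - α))) *
        ENNReal.ofReal ((‖z.1‖ ^ ρ + ‖z.2‖) ^ (-(q * (m - β)))) := by fun_prop
  calc ∫⁻ z in {z : Space n m | 2 * r < ‖z.1‖},
        ‖kernel n m α β ρ (z - w) - kernel n m α β ρ z‖ₑ ^ q
      ≤ ∫⁻ z in {z : Space n m | 2 * r < ‖z.1‖},
        ENNReal.ofReal ((K * r) ^ q * ‖z.1‖ ^ (-q - q * (n - α))) *
          ENNReal.ofReal ((‖z.1‖ ^ ρ + ‖z.2‖) ^ (-(q * (m - β)))) := by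
        refine setLIntegral_mono hmG fun z hz => ?_
        have hz : 2 * r < ‖z.1‖ := hz
        have hx : 0 < ‖z.1‖ := by linarith
        have hw1 : ‖w.1‖ ≤ s := by simpa using hw.1
        have hw2 : ‖w.2‖ ≤ s := by simpa using hw.2
        rw [← ENNReal.ofReal_mul (by positivity), Real.enorm_eq_ofReal_abs,
          ENNReal.ofReal_rpow_of_nonneg (abs_nonneg _) hq0.le]
        refine ENNReal.ofReal_le_ofReal ?_
        calc _ ≤ (K * (r / ‖z.1‖) * kernel n m α β ρ z) ^ q :=
              Real.rpow_le_rpow (abs_nonneg _)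
                (hker r z w hr hz (hw1.trans hsr) (hw2.trans hsrρ)) hq0.le
          _ = _ := by
              have e1 : K * (r / ‖z.1‖) * kernel n m α β ρ z =
                  (K * r) * (‖z.1‖ ^ (-1 - ((n : ℝ) - α)) *
                    (‖z.1‖ ^ ρ + ‖z.2‖) ^ (-((m : ℝ) - β))) := by
                rw [kernel_eq, sub_eq_add_neg (-1 : ℝ), Real.rpow_add hx, Real.rpow_neg_one]
                ring
              rw [e1, Real.mul_rpow (x := K * r) (by positivity) (by positivity),
                Real.mul_rpow (x := ‖z.1‖ ^ (-1 - ((n : ℝ) - α))) (by positivity) (by positivity),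
                ← Real.rpow_mul hx.le, ← Real.rpow_mul (by positivity)]
              ring_nf
    _ = ∫⁻ x in {x : EuclideanSpace ℝ (Fin n) | 2 * r < ‖x‖},
          ENNReal.ofReal ((K * r) ^ q * ‖x‖ ^ (-q - q * (n - α))) *
            ∫⁻ y : EuclideanSpace ℝ (Fin m),
              ENNReal.ofReal ((‖x‖ ^ ρ + ‖y‖) ^ (-(q * (m - β)))) := by
        rw [hset, Measure.volume_eq_prod, ← Measure.prod_restrict, Measure.restrict_univ,
          lintegral_prod _ hmG.aemeasurable]
        refine lintegral_congr fun x => ?_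
        dsimp only
        rw [lintegral_const_mul _ (by fun_prop)]
    _ ≤ ∫⁻ x in {x : EuclideanSpace ℝ (Fin n) | 2 * r < ‖x‖},
          ENNReal.ofReal ((K * r) ^ q) * A * normPow (n + q) x := by
        refine setLIntegral_mono (by fun_prop) fun x hx => ?_
        have hx : 2 * r < ‖x‖ := hx
        have hx0 : 0 < ‖x‖ := by linarith
        refine (mul_le_mul_right (hA _ (by positivity)) _).trans_eq ?_
        rw [normPow_of_ne (norm_pos_iff.1 hx0), ENNReal.ofReal_mul (by positivity),
          mul_comm (A : ℝ≥0∞),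
          mul_assoc, ← mul_assoc (ENNReal.ofReal (‖x‖ ^ (-q - q * (n - α)))),
          ← ENNReal.ofReal_mul (by positivity), ← Real.rpow_mul hx0.le, ← Real.rpow_add hx0,
          mul_assoc, mul_comm (A : ℝ≥0∞)]
        congr 4
        linear_combination hhom
    _ = ENNReal.ofReal ((K * r) ^ q) * A *
          ∫⁻ x in {x : EuclideanSpace ℝ (Fin n) | 2 * r < ‖x‖}, normPow (n + q) x :=
        lintegral_const_mul _ (measurable_normPow _)
    _ ≤ ENNReal.ofReal ((K * r) ^ q) * A * (B * ENNReal.ofReal ((2 * r) ^ (n - (n + q)))) := by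
        gcongr
        refine (lintegral_mono_set fun x (hx : 2 * r < ‖x‖) => ?_).trans (hB _ (by positivity))
        exact hx.le
    _ = A * B * ENNReal.ofReal ((K * r) ^ q * (2 * r) ^ (n - (n + q))) := by
        rw [ENNReal.ofReal_mul (by positivity)]; ring
    _ = _ := by
        have : (K * r) ^ q * (2 * r) ^ ((n : ℝ) - (n + q)) = K ^ q * 2 ^ (-q) := by
          rw [sub_add_cancel_left, Real.mul_rpow hK hr.le, Real.mul_rpow two_pos.le hr.le]
          have : r ^ q * r ^ (-q) = 1 := by rw [← Real.rpow_add hr]; simp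
          linear_combination K ^ q * 2 ^ (-q) * this
        rw [this]
        push_cast
        rfl

end UniformBounds

instance (n m : ℕ) : Measure.IsAddHaarMeasure (volume : Measure (Space n m)) :=
  inferInstanceAs (Measure.IsAddHaarMeasure
    ((volume : Measure (EuclideanSpace ℝ (Fin n))).prod
      (volume : Measure (EuclideanSpace ℝ (Fin m)))))

/-! ### The uniform bound on atoms. -/

section AtomBound

variable {𝕜 : Type*} [RCLike 𝕜] {n m : ℕ} {α β ρ q : ℝ}

lemma lintegral_mul_enorm_le_of_support_subset {K s : ℝ} (hK : 0 ≤ K) {a : Space n m → 𝕜}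
    (hsupp : Function.support a ⊆ box n m s s)
    (hbd : ∀ z, ‖a z‖ ≤ K * s ^ (-((n : ℝ) + m))) (g : Space n m → ℝ≥0∞) :
    ∫⁻ w, g w * ‖a w‖ₑ ≤
      ENNReal.ofReal K * (ENNReal.ofReal (s ^ (-((n : ℝ) + m))) * ∫⁻ w in box n m s s, g w) := by
  rw [← mul_assoc, ← ENNReal.ofReal_mul hK, ← lintegral_const_mul' _ _ ENNReal.ofReal_ne_top,
    ← lintegral_indicator (measurableSet_box s s)]
  refine lintegral_mono fun w => ?_
  by_cases hw : w ∈ box n m s s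
  · rw [Set.indicator_of_mem hw, mul_comm]
    gcongr
    rw [← ofReal_norm]
    exact ENNReal.ofReal_le_ofReal (hbd w)
  · have : a w = 0 := by
      by_contra h
      exact hw (hsupp h)
    simp [this]

lemma exists_lintegral_enorm_fracIntegral_rpow_le [NeZero n] [NeZero m] (hα : 0 < α) (hαn : α < n)
    (hβ : 0 < β) (hβm : β < m) (hρ : 1 ≤ ρ) (hq : 1 < q) (hqα : q * (n - α) < n)
    (hqβ : m < q * (m - β)) (hhom : n - q * (n - α) + ρ * (m - q * (m - β)) = 0)
    {K : ℝ} (hK : 0 ≤ K) :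
    ∃ C : ℝ≥0, ∀ (s : ℝ) (a : Space n m → 𝕜), 0 < s → AEStronglyMeasurable a →
      Function.support a ⊆ box n m s s → (∀ z, ‖a z‖ ≤ K * s ^ (-((n : ℝ) + m))) →
      ∫ z, a z = 0 → ∫⁻ z, ‖fracIntegral n m α β ρ a z‖ₑ ^ q ≤ C := by
  have hq0 : 0 < q := by linarith
  have hρ0 : 0 < ρ := by linarith
  obtain ⟨C₁, hC₁⟩ := exists_setLIntegral_near_le hαn hα hβ hβm hρ hq hqα hhom
  obtain ⟨C₂, hC₂⟩ := exists_setLIntegral_farSnd_le hαn hβm hq hqα hqβ hhom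
  obtain ⟨C₃, hC₃⟩ := exists_setLIntegral_farFst_le hρ hq hqβ hhom
  refine ⟨K.toNNReal ^ q * (C₁ + C₂ + C₃), fun s a hs hmeas hsupp hbd hint => ?_⟩
  -- Here r = max(s, s^{1/ρ}), the least r whose nonisotropic box contains the isotropic box of
  -- radius s; since ρ ≥ 1, the maximum changes at s = 1.
  obtain ⟨r, hr, hsr, hsrρ, hs_eq⟩ : ∃ r : ℝ, 0 < r ∧ s ≤ r ∧ s ≤ r ^ ρ ∧ (s = r ∨ s = r ^ ρ) := by
    rcases le_total 1 s with h | h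
    · exact ⟨s, hs, le_rfl, by simpa using Real.rpow_le_rpow_of_exponent_le h hρ, Or.inl rfl⟩
    · have e : (s ^ (1 / ρ)) ^ ρ = s := by
        rw [← Real.rpow_mul hs.le, one_div_mul_cancel hρ0.ne', Real.rpow_one]
      refine ⟨s ^ (1 / ρ), by positivity, ?_, e.ge, Or.inr e.symm⟩
      have : 1 / ρ ≤ 1 := by rw [div_le_one hρ0]; exact hρ
      simpa using Real.rpow_le_rpow_of_exponent_ge hs h this
  have hcover : (Set.univ : Set (Space n m)) ⊆ (box n m (2 * r) (2 * r ^ ρ) ∪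
      Metric.closedBall 0 (2 * r) ×ˢ {y | 2 * r ^ ρ ≤ ‖y‖}) ∪ {z | 2 * r < ‖z.1‖} := by
    intro z _
    simp only [box, Set.mem_union, Set.mem_prod, Metric.mem_closedBall, dist_zero_right,
      Set.mem_ofPred_eq]
    rcases le_or_gt ‖z.1‖ (2 * r) with h1 | h1
    · rcases le_total ‖z.2‖ (2 * r ^ ρ) with h2 | h2
      · exact Or.inl (Or.inl ⟨h1, h2⟩)
      · exact Or.inl (Or.inr ⟨h1, h2⟩)
    · exact Or.inr h1
  have hsize : ∀ A : Set (Space n m), ∫⁻ z in A, ‖fracIntegral n m α β ρ a z‖ₑ ^ q ≤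
      ENNReal.ofReal K ^ q * ∫⁻ z in A, boxAverage n m α β ρ s z ^ q := by
    intro A
    rw [← lintegral_const_mul' _ _ (ENNReal.rpow_ne_top_of_nonneg hq0.le ENNReal.ofReal_ne_top)]
    refine lintegral_mono fun z => ?_
    rw [← ENNReal.mul_rpow_of_nonneg _ _ hq0.le]
    gcongr
    exact (enorm_fracIntegral_le a z).trans
      (lintegral_mul_enorm_le_of_support_subset hK hsupp hbd _)
  have hai : Integrable a := by
    refine ⟨hmeas, ?_⟩
    have := lintegral_mul_enorm_le_of_support_subset hK hsupp hbd 1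
    simp only [Pi.one_apply, one_mul, lintegral_const, Measure.restrict_apply_univ] at this
    exact this.trans_lt (ENNReal.mul_lt_top ENNReal.ofReal_lt_top
      (ENNReal.mul_lt_top ENNReal.ofReal_lt_top (volume_box_ne_top s s).lt_top))
  -- As a has mean zero, the constant Ω(z) may be subtracted under the integral.
  have hcancel : ∀ᵐ z, ‖fracIntegral n m α β ρ a z‖ₑ ≤ ENNReal.ofReal K *
      (ENNReal.ofReal (s ^ (-((n : ℝ) + m))) * ∫⁻ w in box n m s s,
        ‖kernel n m α β ρ (z - w) - kernel n m α β ρ z‖ₑ) := by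
    filter_upwards [ae_integrable_kernel_smul (ρ := ρ) hα hαn hβ hβm hai] with z hz
    have : fracIntegral n m α β ρ a z =
        ∫ w, (kernel n m α β ρ (z - w) - kernel n m α β ρ z) • a w := by
      simp_rw [sub_smul]
      have hz' : Integrable fun w => kernel n m α β ρ z • a w := hai.smul (kernel n m α β ρ z)
      rw [integral_sub hz hz', integral_smul, hint, smul_zero, sub_zero]
      rfl
    rw [this]
    refine (enorm_integral_le_lintegral_enorm _).trans ?_
    simp_rw [enorm_smul]
    exact lintegral_mul_enorm_le_of_support_subset hK hsupp hbd _
  have hfar : ∫⁻ z in {z : Space n m | 2 * r < ‖z.1‖}, ‖fracIntegral n m α β ρ a z‖ₑ ^ q ≤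
      ENNReal.ofReal K ^ q * C₃ := by
    refine le_trans ?_ (mul_le_mul_right (hC₃ s r hs hr hsr hsrρ) _)
    rw [← lintegral_const_mul' _ _ (ENNReal.rpow_ne_top_of_nonneg hq0.le ENNReal.ofReal_ne_top)]
    refine lintegral_mono_ae ?_
    filter_upwards [ae_restrict_of_ae hcancel] with z hz
    rw [← ENNReal.mul_rpow_of_nonneg _ _ hq0.le]
    gcongr
  calc ∫⁻ z, ‖fracIntegral n m α β ρ a z‖ₑ ^ q
      = ∫⁻ z in Set.univ, ‖fracIntegral n m α β ρ a z‖ₑ ^ q := by rw [Measure.restrict_univ]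
    _ ≤ ENNReal.ofReal K ^ q * C₁ + ENNReal.ofReal K ^ q * C₂ + ENNReal.ofReal K ^ q * C₃ := by
        refine (lintegral_mono_set hcover).trans ((lintegral_union_le _ _ _).trans ?_)
        refine add_le_add ((lintegral_union_le _ _ _).trans (add_le_add ?_ ?_)) hfar
        · exact (hsize _).trans (mul_le_mul_right (hC₁ s r hs hr hs_eq) _)
        · exact (hsize _).trans (mul_le_mul_right (hC₂ s r hs hr hsrρ) _)
    _ = _ := by
        rw [ENNReal.coe_mul, ENNReal.coe_rpow_of_nonneg _ hq0.le, ← ENNReal.ofReal]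
        push_cast
        ring

lemma volume_coordBox (d : ℕ) (c : EuclideanSpace ℝ (Fin d)) {s : ℝ} (hs : 0 ≤ s) :
    volume {x : EuclideanSpace ℝ (Fin d) | ∀ i, x i ∈ Set.Icc (c i) (c i + s)} =
      ENNReal.ofReal (s ^ d) := by
  have h := (PiLp.volume_preserving_ofLp (Fin d)).measure_preimage
    (s := Set.Icc (fun i => c i) (fun i => c i + s)) measurableSet_Icc.nullMeasurableSet
  rw [Real.volume_Icc_pi] at h
  simp only [add_sub_cancel_left, Finset.prod_const, Finset.card_univ, Fintype.card_fin] at h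
  rw [ENNReal.ofReal_pow hs, ← h]
  congr 1
  ext x
  simp only [Set.mem_ofPred_eq, Set.mem_preimage, Set.mem_Icc, Pi.le_def, forall_and]

lemma volume_cube (c : Space n m) {s : ℝ} (hs : 0 ≤ s) :
    volume (cube c s) = ENNReal.ofReal (s ^ (n + m)) := by
  have : cube c s = {x : EuclideanSpace ℝ (Fin n) | ∀ i, x i ∈ Set.Icc (c.1 i) (c.1 i + s)} ×ˢ
      {y : EuclideanSpace ℝ (Fin m) | ∀ i, y i ∈ Set.Icc (c.2 i) (c.2 i + s)} := by
    ext z; simp [cube]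
  rw [this, Measure.volume_eq_prod, Measure.prod_prod, volume_coordBox n _ hs,
    volume_coordBox m _ hs, ← ENNReal.ofReal_mul (by positivity), pow_add]

lemma norm_le_of_forall_abs_le {d : ℕ} {x : EuclideanSpace ℝ (Fin d)} {s : ℝ} (hs : 0 ≤ s)
    (h : ∀ i, |x i| ≤ s) : ‖x‖ ≤ d * s := by
  rcases Nat.eq_zero_or_pos d with rfl | hd
  · simp [Subsingleton.elim x 0]
  refine (sq_le_sq₀ (norm_nonneg _) (by positivity)).1 ?_
  rw [EuclideanSpace.norm_sq_eq]
  calc ∑ i, ‖x i‖ ^ 2 ≤ ∑ _i : Fin d, s ^ 2 := by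
        gcongr with i
        exact h i
    _ = d * s ^ 2 := by simp
    _ ≤ d * (d * s ^ 2) := by
        have : (1 : ℝ) ≤ d := by exact_mod_cast hd
        have h2 : 0 ≤ d * s ^ 2 := by positivity
        nlinarith
    _ = (d * s) ^ 2 := by ring

lemma sub_mem_box_of_mem_cube {c z : Space n m} {s : ℝ} (hs : 0 ≤ s) (hz : z ∈ cube c s) :
    z - c ∈ box n m ((n + m) * s) ((n + m) * s) := by
  have h1 : ‖(z - c).1‖ ≤ n * s := by
    refine norm_le_of_forall_abs_le hs fun i => ?_
    have := hz.1 i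
    simp only [Set.mem_Icc] at this
    simp only [Prod.fst_sub, PiLp.sub_apply]
    rw [abs_le]; constructor <;> linarith
  have h2 : ‖(z - c).2‖ ≤ m * s := by
    refine norm_le_of_forall_abs_le hs fun i => ?_
    have := hz.2 i
    simp only [Set.mem_Icc] at this
    simp only [Prod.snd_sub, PiLp.sub_apply]
    rw [abs_le]; constructor <;> linarith
  have hn : (0 : ℝ) ≤ n * s := by positivity
  have hm : (0 : ℝ) ≤ m * s := by positivity
  simp only [box, Set.mem_prod, Metric.mem_closedBall, dist_zero_right]
  constructor <;> linarith

lemma fracIntegral_comp_add (f : Space n m → 𝕜) (c z : Space n m) :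
    fracIntegral n m α β ρ (fun w => f (w + c)) z = fracIntegral n m α β ρ f (z + c) := by
  unfold fracIntegral
  rw [← integral_add_right_eq_self (fun w => kernel n m α β ρ (z + c - w) • f w) c]
  simp only [add_sub_add_right_eq_sub]

lemma exists_eLpNorm_fracIntegral_atom_le [NeZero n] [NeZero m] (hα : 0 < α) (hαn : α < n)
    (hβ : 0 < β) (hβm : β < m) (hρ : 1 ≤ ρ) (hq : 1 < q) (hqα : q * (n - α) < n)
    (hqβ : m < q * (m - β)) (hhom : n - q * (n - α) + ρ * (m - q * (m - β)) = 0) :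
    ∃ C : ℝ≥0, ∀ a : Space n m → 𝕜, IsAtom a →
      eLpNorm (fracIntegral n m α β ρ a) (ENNReal.ofReal q) volume ≤ C := by
  have hq0 : 0 < q := by linarith
  have hD : (0 : ℝ) < n + m := by linarith
  -- A cube of side s, moved so that its corner is at 0, lies in the box of radius (n+m)s. The
  -- constant K converts 1/vol of the cube into the normalization at that larger radius.
  obtain ⟨C, hC⟩ := exists_lintegral_enorm_fracIntegral_rpow_le (𝕜 := 𝕜) hα hαn hβ hβm hρ hq hqα
    hqβ hhom (K := ((n : ℝ) + m) ^ ((n : ℝ) + m)) (by positivity)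
  refine ⟨C ^ (1 / q), fun a ha => ?_⟩
  obtain ⟨hmeas, c, s, hs, hsupp, hbd, hint⟩ := ha
  rw [eLpNorm_eq_lintegral_rpow_enorm_toReal (by simpa using hq0) ENNReal.ofReal_ne_top,
    ENNReal.toReal_ofReal hq0.le, ENNReal.coe_rpow_of_nonneg _ (by positivity)]
  gcongr
  rw [← lintegral_add_right_eq_self _ c]
  simp_rw [← fracIntegral_comp_add]
  refine hC ((n + m) * s) _ (by positivity)
    (hmeas.comp_measurePreserving (measurePreserving_add_right volume c)) ?_ ?_ ?_
  · intro w hw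
    simpa using sub_mem_box_of_mem_cube hs.le (hsupp (show w + c ∈ Function.support a from hw))
  · intro w
    refine (hbd _).trans_eq ?_
    rw [volume_cube c hs.le, ENNReal.toReal_ofReal (by positivity),
      Real.mul_rpow hD.le hs.le, ← mul_assoc, ← Real.rpow_add hD, add_neg_cancel, Real.rpow_zero,
      one_mul, Real.rpow_neg hs.le, ← Nat.cast_add, Real.rpow_natCast, one_div]
  · rw [integral_add_right_eq_self a c, ← hint]
    refine (setIntegral_eq_integral_of_forall_compl_eq_zero fun z hz => ?_).symm
    by_contra h
    exact hz (hsupp h)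

lemma IsAtom.integrable {a : Space n m → 𝕜} (ha : IsAtom a) : Integrable a := by
  obtain ⟨hmeas, c, s, hs, hsupp, hbd, -⟩ := ha
  rw [← integrableOn_iff_integrable_of_support_subset hsupp]
  refine Measure.integrableOn_of_bounded ?_ hmeas (ae_of_all _ hbd)
  rw [volume_cube c hs.le]
  exact ENNReal.ofReal_ne_top

end AtomBound

/-! ### From atoms to the Hardy space. -/

section AtomicSums

variable {𝕜 : Type*} [RCLike 𝕜] {n m : ℕ} {α β ρ q : ℝ}

lemma tendsto_eLpNorm_restrict_fracIntegral [NeZero n] [NeZero m] (hα : 0 < α) (hαn : α < n)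
    (hβ : 0 < β) (hβm : β < m) {f : Space n m → 𝕜} {F : ℕ → Space n m → 𝕜}
    (hf : Integrable f) (hF : ∀ N, Integrable (F N))
    (hlim : Tendsto (fun N => eLpNorm (F N - f) 1 volume) atTop (𝓝 0)) {R : ℝ} (hR : 0 < R) :
    Tendsto (fun N => eLpNorm (fracIntegral n m α β ρ (F N) - fracIntegral n m α β ρ f) 1
      (volume.restrict (box n m R R))) atTop (𝓝 0) := by
  obtain ⟨C, hC⟩ := exists_setLIntegral_box_lintegral_enorm_le (ρ := ρ) hα hαn hβ hβm hR
  have hlim' := ENNReal.Tendsto.const_mul (a := (C : ℝ≥0∞)) hlim (Or.inr ENNReal.coe_ne_top)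
  rw [mul_zero] at hlim'
  refine tendsto_of_tendsto_of_tendsto_of_le_of_le tendsto_const_nhds hlim' (fun _ => bot_le)
    fun N => ?_
  dsimp only
  rw [eLpNorm_one_eq_lintegral_enorm, eLpNorm_one_eq_lintegral_enorm]
  refine le_trans (lintegral_mono_ae ?_) (hC (fun w => ‖(F N - f) w‖ₑ) ((hF N).sub hf).1.enorm)
  filter_upwards [ae_restrict_of_ae (ae_integrable_kernel_smul (ρ := ρ) hα hαn hβ hβm hf),
    ae_restrict_of_ae (ae_integrable_kernel_smul (ρ := ρ) hα hαn hβ hβm (hF N))] with z h1 h2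
  refine le_trans (le_of_eq ?_) (enorm_fracIntegral_le (F N - f) z)
  congr 1
  simp only [fracIntegral, Pi.sub_apply, smul_sub]
  rw [integral_sub h2 h1]

/-- On each box the fractional integrals converge in L¹, so a subsequence converges almost
everywhere and Fatou's lemma gives the bound there. Exhausting the space by boxes gives it globally.
-/
lemma eLpNorm_fracIntegral_le_of_tendsto [NeZero n] [NeZero m] (hα : 0 < α) (hαn : α < n)
    (hβ : 0 < β) (hβm : β < m) {f : Space n m → 𝕜} {F : ℕ → Space n m → 𝕜}
    (hf : Integrable f) (hF : ∀ N, Integrable (F N))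
    (hlim : Tendsto (fun N => eLpNorm (F N - f) 1 volume) atTop (𝓝 0)) {p M : ℝ≥0∞}
    (hM : ∀ N, eLpNorm (fracIntegral n m α β ρ (F N)) p volume ≤ M) :
    eLpNorm (fracIntegral n m α β ρ f) p volume ≤ M := by
  have hmf := aestronglyMeasurable_fracIntegral (α := α) (β := β) (ρ := ρ) hf.1
  have hmF := fun N => aestronglyMeasurable_fracIntegral (α := α) (β := β) (ρ := ρ) (hF N).1
  have hbox : ∀ k : ℕ, eLpNorm ((box n m (k + 1) (k + 1)).indicator (fracIntegral n m α β ρ f)) p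
      volume ≤ M := by
    intro k
    rw [eLpNorm_indicator_eq_eLpNorm_restrict (measurableSet_box _ _)]
    obtain ⟨ns, -, hns⟩ := (tendstoInMeasure_of_tendsto_eLpNorm one_ne_zero
      (fun N => (hmF N).restrict) hmf.restrict
      (tendsto_eLpNorm_restrict_fracIntegral (ρ := ρ) hα hαn hβ hβm hf hF hlim
        (R := (k : ℝ) + 1) (by positivity))).exists_seq_tendsto_ae
    refine Lp.eLpNorm_le_of_ae_tendsto (u := atTop) (Eventually.of_forall fun N => ?_)
      (fun N => (hmF (ns N)).restrict) hns
    exact (eLpNorm_mono_measure _ Measure.restrict_le_self).trans (hM _)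
  refine Lp.eLpNorm_le_of_ae_tendsto (u := atTop) (Eventually.of_forall hbox)
    (fun k => hmf.indicator (measurableSet_box _ _)) (ae_of_all _ fun z => ?_)
  obtain ⟨N, hN⟩ := exists_nat_ge (max ‖z.1‖ ‖z.2‖)
  refine tendsto_const_nhds.congr' ?_
  filter_upwards [eventually_ge_atTop N] with k hk
  have h1 := (le_max_left _ _).trans hN
  have h2 := (le_max_right _ _).trans hN
  have hk' : (N : ℝ) ≤ k := by exact_mod_cast hk
  rw [Set.indicator_of_mem]
  simp only [box, Set.mem_prod, Metric.mem_closedBall, dist_zero_right]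
  constructor <;> linarith

lemma eLpNorm_fracIntegral_sum_le [NeZero n] [NeZero m] (hα : 0 < α) (hαn : α < n)
    (hβ : 0 < β) (hβm : β < m) {p C : ℝ≥0∞} (hp : 1 ≤ p) (lam : ℕ → 𝕜) {a : ℕ → Space n m → 𝕜}
    (ha : ∀ k, Integrable (a k))
    (hC : ∀ k, eLpNorm (fracIntegral n m α β ρ (a k)) p volume ≤ C) (N : ℕ) :
    eLpNorm (fracIntegral n m α β ρ fun z => ∑ k ∈ Finset.range N, lam k * a k z) p volume ≤
      C * ∑' k, ‖lam k‖ₑ := by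
  have hae : fracIntegral n m α β ρ (fun z => ∑ k ∈ Finset.range N, lam k * a k z) =ᵐ[volume]
      ∑ k ∈ Finset.range N, lam k • fracIntegral n m α β ρ (a k) := by
    filter_upwards [ae_all_iff.2 fun k =>
      ae_integrable_kernel_smul (ρ := ρ) hα hαn hβ hβm (ha k)] with z hz
    simp only [fracIntegral, Finset.smul_sum, Finset.sum_apply, Pi.smul_apply, smul_eq_mul,
      ← mul_smul_comm]
    rw [integral_finsetSum _ fun k _ => (hz k).const_mul (lam k)]
    simp_rw [integral_const_mul]
  rw [eLpNorm_congr_ae hae]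
  calc _ ≤ ∑ k ∈ Finset.range N, eLpNorm (lam k • fracIntegral n m α β ρ (a k)) p volume :=
        eLpNorm_sum_le (fun k _ => (aestronglyMeasurable_fracIntegral (ha k).1).const_smul _) hp
    _ ≤ ∑ k ∈ Finset.range N, ‖lam k‖ₑ * C := by
        gcongr with k
        rw [eLpNorm_const_smul]
        gcongr
        exact hC k
    _ = C * ∑ k ∈ Finset.range N, ‖lam k‖ₑ := by rw [← Finset.sum_mul, mul_comm]
    _ ≤ _ := by gcongr; exact ENNReal.sum_le_tsum _

lemma eLpNorm_fracIntegral_le_hardyNorm [NeZero n] [NeZero m] (hα : 0 < α) (hαn : α < n)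
    (hβ : 0 < β) (hβm : β < m) {p : ℝ≥0∞} {C : ℝ≥0} (hp : 1 ≤ p)
    (hC : ∀ a : Space n m → 𝕜, IsAtom a → eLpNorm (fracIntegral n m α β ρ a) p volume ≤ C)
    {f : Space n m → 𝕜} (hf : MemHardy f) :
    MemLp (fracIntegral n m α β ρ f) p volume ∧
      eLpNorm (fracIntegral n m α β ρ f) p volume ≤ C * hardyNorm f := by
  have key : ∀ (lam : ℕ → 𝕜) (a : ℕ → Space n m → 𝕜), IsAtomicDecomposition f lam a →
      eLpNorm (fracIntegral n m α β ρ f) p volume ≤ C * ∑' k, ‖lam k‖ₑ := by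
    rintro lam a ⟨hint, hat, -, hlim⟩
    refine eLpNorm_fracIntegral_le_of_tendsto (ρ := ρ) hα hαn hβ hβm hint
      (F := fun N z => ∑ k ∈ Finset.range N, lam k * a k z)
      (fun N => integrable_finsetSum _ fun k _ => (hat k).integrable.const_mul _) ?_
      fun N => eLpNorm_fracIntegral_sum_le hα hαn hβ hβm hp lam (fun k => (hat k).integrable)
        (fun k => hC _ (hat k)) N
    refine hlim.congr fun N => ?_
    rw [← eLpNorm_neg]
    congr 1
    ext z
    simp
  refine ⟨⟨?_, ?_⟩, ?_⟩
  · obtain ⟨lam, a, h⟩ := hf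
    exact aestronglyMeasurable_fracIntegral h.1.1
  · obtain ⟨lam, a, h⟩ := hf
    refine (key lam a h).trans_lt (ENNReal.mul_lt_top ENNReal.coe_lt_top ?_)
    have hs := h.2.2.1
    have : ∑' k, ‖lam k‖ₑ = ∑' k, ENNReal.ofReal ‖lam k‖ := by simp_rw [ofReal_norm]
    rw [this, ← ENNReal.ofReal_tsum_of_nonneg (fun k => norm_nonneg _) hs]
    exact ENNReal.ofReal_lt_top
  · unfold hardyNorm
    -- For C = 0 the constant cannot be moved inside the infimum: the infimum over an empty family
    -- of proofs is ∞, and 0 · ∞ = 0.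
    by_cases hC0 : C = 0
    · obtain ⟨lam, a, h⟩ := hf
      simpa [hC0] using key lam a h
    · have hC0' : (C : ℝ≥0∞) ≠ 0 := by simpa using hC0
      simp_rw [ENNReal.mul_iInf_of_ne hC0' ENNReal.coe_ne_top]
      exact le_iInf fun lam => le_iInf fun a => le_iInf fun h => key lam a h

end AtomicSums

/-! ### Test atoms and the necessary conditions. -/

section Necessity

variable {𝕜 : Type*} [RCLike 𝕜] {n m : ℕ} {α β ρ q : ℝ}

lemma IsAtom.isAtomicDecomposition {a : Space n m → 𝕜} (ha : IsAtom a) :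
    IsAtomicDecomposition a (Pi.single 0 1) fun _ => a := by
  refine ⟨ha.integrable, fun _ => ha, ?_, ?_⟩
  · refine summable_of_ne_finset_zero (s := {0}) fun k hk => ?_
    have : k ≠ 0 := by simpa using hk
    simp [this]
  · refine tendsto_const_nhds.congr' ?_
    filter_upwards [eventually_ge_atTop 1] with N hN
    have : (fun z => a z - ∑ k ∈ Finset.range N, (Pi.single 0 1 : ℕ → 𝕜) k * a z) = 0 := by
      ext z
      rw [Finset.sum_eq_single_of_mem 0 (Finset.mem_range.2 hN) fun k _ hk => by simp [hk]]
      simp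
    rw [this, eLpNorm_zero]

lemma IsAtom.memHardy {a : Space n m → 𝕜} (ha : IsAtom a) : MemHardy a :=
  ⟨_, _, ha.isAtomicDecomposition⟩

lemma IsAtom.hardyNorm_le_one {a : Space n m → 𝕜} (ha : IsAtom a) : hardyNorm a ≤ 1 := by
  refine (iInf_le _ (Pi.single 0 1)).trans ((iInf_le _ fun _ => a).trans
    ((iInf_le _ ha.isAtomicDecomposition).trans ?_))
  rw [tsum_eq_single 0 fun k hk => by simp [hk]]
  simp

/-- A dipole on a box and its translate by `h` is, after normalization, an atom; its fractional
integral is bounded below wherever translation by `h` halves the kernel. -/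
lemma exists_dipole_atom [NeZero n] [NeZero m] (hα : 0 < α) (hαn : α < n)
    (hβ : 0 < β) (hβm : β < m) (ρ : ℝ) {D : ℝ} (hD : 0 ≤ D) :
    ∃ c : ℝ, 0 < c ∧ ∀ (s : ℝ) (h : Space n m), 0 < s → ‖h.1‖ ≤ D * s → ‖h.2‖ ≤ D * s →
      ∃ a : Space n m → 𝕜, IsAtom a ∧ ∀ᵐ z, ∀ k₀ : ℝ,
        (∀ w ∈ box n m s s, w.1 ≠ z.1 →
          kernel n m α β ρ (z - w - h) ≤ kernel n m α β ρ (z - w) / 2 ∧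
          k₀ ≤ kernel n m α β ρ (z - w)) → c * k₀ ≤ ‖fracIntegral n m α β ρ a z‖ := by
  have hV := toReal_volume_box_one_pos n m
  refine ⟨(volume (box n m 1 1)).toReal / (2 * (2 * (D + 1)) ^ (n + m)), by positivity,
    fun s h hs h1 h2 => ?_⟩
  set E := box n m s s with hE
  have hEm : MeasurableSet E := measurableSet_box s s
  have hEfin : volume E ≠ ∞ := volume_box_ne_top s s
  -- The cube of side 2(D+1)s centred at 0 contains both the box and its translate; κ is the
  -- reciprocal of its volume.
  set κ : ℝ := 1 / (2 * (D + 1) * s) ^ (n + m) with hκ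
  have hκ0 : 0 < κ := by positivity
  set φ : Space n m → ℝ := E.indicator 1 with hφ
  have hφm : Measurable φ := measurable_one.indicator hEm
  have hφi : Integrable φ := (integrable_indicator_iff hEm).2 (integrableOn_const hEfin)
  have hφi' : Integrable fun w => φ (w - h) := hφi.comp_sub_right h
  have hφ01 : ∀ w, 0 ≤ φ w ∧ φ w ≤ 1 := fun w => by
    by_cases hw : w ∈ E <;> simp [hφ, hw]
  set c : Space n m :=
      (WithLp.toLp 2 fun _ => -((D + 1) * s), WithLp.toLp 2 fun _ => -((D + 1) * s))
    with hc
  have hcube : ∀ w : Space n m, ‖w.1‖ ≤ (D + 1) * s → ‖w.2‖ ≤ (D + 1) * s →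
      w ∈ cube c (2 * (D + 1) * s) := by
    intro w hw1 hw2
    constructor
    · intro i
      have := (PiLp.norm_apply_le w.1 i).trans hw1
      rw [Real.norm_eq_abs, abs_le] at this
      simp only [hc, Set.mem_Icc]
      constructor <;> linarith
    · intro i
      have := (PiLp.norm_apply_le w.2 i).trans hw2
      rw [Real.norm_eq_abs, abs_le] at this
      simp only [hc, Set.mem_Icc]
      constructor <;> linarith
  have hs2 : 0 < 2 * (D + 1) * s := by positivity
  have hDs : 0 ≤ D * s := by positivity
  have hmemE : ∀ w : Space n m, w ∈ E ↔ ‖w.1‖ ≤ s ∧ ‖w.2‖ ≤ s := fun w => by simp [hE, box]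
  have hsupp : Function.support (fun w => ((κ * (φ w - φ (w - h)) : ℝ) : 𝕜)) ⊆
      cube c (2 * (D + 1) * s) := by
    intro w hw
    by_contra hcon
    refine hw ?_
    have e1 : w ∉ E := fun hwE => hcon (by
      rw [hmemE] at hwE
      exact hcube w (by linarith) (by linarith))
    have e2 : w - h ∉ E := fun hwE => hcon (by
      rw [hmemE] at hwE
      have t1 := norm_sub_norm_le w.1 h.1
      have t2 := norm_sub_norm_le w.2 h.2
      have t3 : ‖w.1 - h.1‖ ≤ s := hwE.1
      have t4 : ‖w.2 - h.2‖ ≤ s := hwE.2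
      exact hcube w (by linarith) (by linarith))
    simp [hφ, e1, e2]
  refine ⟨fun w => ((κ * (φ w - φ (w - h)) : ℝ) : 𝕜),
    ⟨?_, c, 2 * (D + 1) * s, hs2, hsupp, ?_, ?_⟩, ?_⟩
  · exact (RCLike.measurable_ofReal.comp
      ((hφm.sub (hφm.comp (measurable_id.sub_const h))).const_mul κ)).aestronglyMeasurable
  · intro w
    rw [volume_cube c hs2.le, ENNReal.toReal_ofReal (by positivity), ← hκ, RCLike.norm_ofReal,
      abs_mul, abs_of_pos hκ0]
    have : |φ w - φ (w - h)| ≤ 1 := by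
      have t1 := hφ01 w
      have t2 := hφ01 (w - h)
      rw [abs_le]; constructor <;> linarith
    nlinarith
  · rw [setIntegral_eq_integral_of_forall_compl_eq_zero fun z hz => by
      by_contra hne; exact hz (hsupp hne), integral_ofReal, integral_const_mul,
      integral_sub hφi hφi', integral_sub_right_eq_self φ h, sub_self, mul_zero]
    simp
  · have hker1 := ae_integrable_kernel_smul (ρ := ρ) hα hαn hβ hβm hφi
    have hker2 := ae_integrable_kernel_smul (ρ := ρ) hα hαn hβ hβm hφi'
    -- The exceptional null set is fixed before k₀ is chosen, so k₀ may depend on z.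
    filter_upwards [hker1, hker2] with z hz1 hz2 k₀ hk
    have hfrac : fracIntegral n m α β ρ (fun w => ((κ * (φ w - φ (w - h)) : ℝ) : 𝕜)) z =
        ((κ * ((∫ w, kernel n m α β ρ (z - w) • φ w) -
          ∫ w, kernel n m α β ρ (z - w) • φ (w - h)) : ℝ) : 𝕜) := by
      rw [← integral_sub hz1 hz2, ← integral_const_mul, ← integral_ofReal, fracIntegral]
      refine integral_congr_ae (ae_of_all _ fun w => ?_)
      simp only [RCLike.real_smul_eq_coe_mul, smul_eq_mul]
      push_cast
      ring
    -- A change of variables moves the translation from the box to the kernel, where it at least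
    -- halves the value.
    have hshift : ∫ w, kernel n m α β ρ (z - w) • φ (w - h) =
        ∫ w, kernel n m α β ρ (z - w - h) • φ w := by
      rw [← integral_add_right_eq_self _ h]
      simp only [add_sub_cancel_right, sub_add_eq_sub_sub]
    have hz3 : Integrable fun w => kernel n m α β ρ (z - w - h) • φ w := by
      have := hz2.comp_add_right h
      simpa only [add_sub_cancel_right, sub_add_eq_sub_sub] using this
    have hne : ∀ᵐ w : Space n m, w.1 ≠ z.1 := by
      have : ∀ᵐ u : EuclideanSpace ℝ (Fin n), u ≠ z.1 := by simp [ae_iff]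
      exact Measure.quasiMeasurePreserving_fst.ae this
    have hlow : k₀ / 2 * (volume E).toReal ≤ (∫ w, kernel n m α β ρ (z - w) • φ w) -
        ∫ w, kernel n m α β ρ (z - w) • φ (w - h) := by
      rw [hshift, ← integral_sub hz1 hz3]
      have : k₀ / 2 * (volume E).toReal = ∫ w, k₀ / 2 * φ w := by
        rw [integral_const_mul, hφ, integral_indicator_one hEm, Measure.real]
      rw [this]
      refine integral_mono_ae (hφi.const_mul _) (hz1.sub hz3) ?_
      filter_upwards [hne] with w hw
      by_cases hwE : w ∈ E
      · have := hk w hwE hw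
        simp only [hφ, Set.indicator_of_mem hwE, Pi.one_apply, smul_eq_mul, mul_one]
        linarith
      · simp [hφ, hwE]
    rw [hfrac, RCLike.norm_ofReal]
    refine le_trans (le_of_eq ?_) ((mul_le_mul_of_nonneg_left hlow hκ0.le).trans (le_abs_self _))
    rw [hE, volume_box s hs.le, ENNReal.toReal_mul, ENNReal.toReal_ofReal (by positivity), hκ,
      ← Nat.cast_add, Real.rpow_natCast, mul_pow (2 * (D + 1)) s]
    field_simp

lemma exists_one_le_rpow_neg_le_half {b : ℝ} (hb : 0 < b) :
    ∃ M : ℝ, 1 ≤ M ∧ M ^ (-b) ≤ 1 / 2 := by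
  refine ⟨2 ^ (1 / b), Real.one_le_rpow (by norm_num) (by positivity), ?_⟩
  rw [← Real.rpow_mul (by norm_num)]
  have : 1 / b * -b = -1 := by field_simp
  rw [this, Real.rpow_neg_one]
  norm_num

lemma exists_dipole_atom_fst [NeZero n] [NeZero m] (hα : 0 < α) (hαn : α < n)
    (hβ : 0 < β) (hβm : β < m) (hρ : 0 < ρ) :
    ∃ c : ℝ, 0 < c ∧ ∀ s : ℝ, 0 < s → ∃ a : Space n m → 𝕜, IsAtom a ∧
      ∀ᵐ z : Space n m, ‖z.1‖ ≤ s →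
        c * (s ^ (-((n : ℝ) - α)) * ((2 * s) ^ ρ + s + ‖z.2‖) ^ (-((m : ℝ) - β))) ≤
          ‖fracIntegral n m α β ρ a z‖ := by
  obtain ⟨M, hM1, hM⟩ := exists_one_le_rpow_neg_le_half (b := n - α) (by linarith)
  -- For |x|, |u| ≤ s one has |x-u| ≤ 2s, so a shift of length (2+2M)s leaves a vector of length at
  -- least 2Ms ≥ M|x-u|.
  obtain ⟨c, hc, H⟩ := exists_dipole_atom (𝕜 := 𝕜) hα hαn hβ hβm ρ (D := 2 + 2 * M) (by linarith)
  refine ⟨c * 2 ^ (-((n : ℝ) - α)), by positivity, fun s hs => ?_⟩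
  obtain ⟨v, hv⟩ := exists_norm_eq (EuclideanSpace ℝ (Fin n))
    (show 0 ≤ (2 + 2 * M) * s by positivity)
  obtain ⟨a, ha, hz⟩ := H s (v, 0) hs hv.le (by simp; positivity)
  refine ⟨a, ha, ?_⟩
  filter_upwards [hz] with z hz hz1
  refine le_trans (le_of_eq ?_) (hz ((2 * s) ^ (-((n : ℝ) - α)) *
    ((2 * s) ^ ρ + s + ‖z.2‖) ^ (-((m : ℝ) - β))) fun w hw hwz => ?_)
  · rw [Real.mul_rpow (z := -((n : ℝ) - α)) two_pos.le hs.le]; ring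
  have hw1 : ‖w.1‖ ≤ s := by simpa using hw.1
  have hw2 : ‖w.2‖ ≤ s := by simpa using hw.2
  have hX : 0 < ‖(z - w).1‖ := norm_pos_iff.2 (sub_ne_zero.2 hwz.symm)
  have hX2 : ‖(z - w).1‖ ≤ 2 * s := (norm_sub_le z.1 w.1).trans (by linarith)
  have hY : ‖(z - w).2‖ ≤ s + ‖z.2‖ := (norm_sub_le z.2 w.2).trans (by linarith)
  have hX' : M * ‖(z - w).1‖ ≤ ‖(z - w - (v, 0)).1‖ := by
    have := norm_sub_norm_le v (z - w).1
    rw [norm_sub_rev] at this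
    have e : (z - w - (v, 0)).1 = (z - w).1 - v := rfl
    rw [e]
    nlinarith
  have hY' : (z - w - (v, 0)).2 = (z - w).2 := by simp
  have hXX : ‖(z - w).1‖ ≤ ‖(z - w - (v, 0)).1‖ := by nlinarith
  rw [kernel_eq, kernel_eq, hY']
  constructor
  · calc _ ≤ (M * ‖(z - w).1‖) ^ (-((n : ℝ) - α)) *
          (‖(z - w).1‖ ^ ρ + ‖(z - w).2‖) ^ (-((m : ℝ) - β)) := by
          refine mul_le_mul ?_ ?_ (by positivity) (by positivity)
          · exact Real.rpow_le_rpow_of_nonpos (by positivity) hX' (by linarith)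
          · refine Real.rpow_le_rpow_of_nonpos (by positivity) ?_ (by linarith)
            gcongr
      _ = M ^ (-((n : ℝ) - α)) * (‖(z - w).1‖ ^ (-((n : ℝ) - α)) *
          (‖(z - w).1‖ ^ ρ + ‖(z - w).2‖) ^ (-((m : ℝ) - β))) := by
          rw [Real.mul_rpow (by linarith) hX.le, mul_assoc]
      _ ≤ 1 / 2 * (‖(z - w).1‖ ^ (-((n : ℝ) - α)) *
          (‖(z - w).1‖ ^ ρ + ‖(z - w).2‖) ^ (-((m : ℝ) - β))) := by gcongr
      _ = _ := by ring
  · refine mul_le_mul ?_ ?_ (by positivity) (by positivity)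
    · exact Real.rpow_le_rpow_of_nonpos hX hX2 (by linarith)
    · refine Real.rpow_le_rpow_of_nonpos (by positivity) ?_ (by linarith)
      rw [add_assoc]
      gcongr

/-- For small r the cube scale r^ρ is much shorter than r, so a shift in x comparable to it would
barely change the kernel; the dipole must point in the y direction. -/
lemma exists_dipole_atom_snd [NeZero n] [NeZero m] (hα : 0 < α) (hαn : α < n)
    (hβ : 0 < β) (hβm : β < m) (hρ : 1 ≤ ρ) :
    ∃ c : ℝ, 0 < c ∧ ∀ r : ℝ, 0 < r → r ≤ 1 → ∃ a : Space n m → 𝕜, IsAtom a ∧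
      ∀ᵐ z : Space n m, z ∈ box n m r (r ^ ρ) →
        c * (r ^ (-((n : ℝ) - α)) * (r ^ ρ) ^ (-((m : ℝ) - β))) ≤
          ‖fracIntegral n m α β ρ a z‖ := by
  obtain ⟨M, hM1, hM⟩ := exists_one_le_rpow_neg_le_half (b := m - β) (by linarith)
  set A : ℝ := 2 ^ ρ + 2 with hA
  have hA0 : 0 < A := by positivity
  -- On the relevant set |x-u|^ρ + |y-v| is at most A r^ρ and |y-v| at most 2r^ρ, so the shift
  -- multiplies the sum by at least M.
  obtain ⟨c, hc, H⟩ := exists_dipole_atom (𝕜 := 𝕜) hα hαn hβ hβm ρ (D := 2 + M * A) (by positivity)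
  refine ⟨c * (2 ^ (-((n : ℝ) - α)) * A ^ (-((m : ℝ) - β))), by positivity, fun r hr hr1 => ?_⟩
  have hs : 0 < r ^ ρ := by positivity
  have hsr : r ^ ρ ≤ r := by simpa using Real.rpow_le_rpow_of_exponent_ge hr hr1 hρ
  obtain ⟨v, hv⟩ := exists_norm_eq (EuclideanSpace ℝ (Fin m))
    (show 0 ≤ (2 + M * A) * r ^ ρ by positivity)
  obtain ⟨a, ha, hz⟩ := H (r ^ ρ) (0, v) hs (by simp; positivity) hv.le
  refine ⟨a, ha, ?_⟩
  filter_upwards [hz] with z hz hzb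
  have hz1 : ‖z.1‖ ≤ r := by simpa using hzb.1
  have hz2 : ‖z.2‖ ≤ r ^ ρ := by simpa using hzb.2
  refine le_trans (le_of_eq ?_) (hz ((2 * r) ^ (-((n : ℝ) - α)) *
    (A * r ^ ρ) ^ (-((m : ℝ) - β))) fun w hw hwz => ?_)
  · rw [Real.mul_rpow two_pos.le hr.le, Real.mul_rpow hA0.le hs.le]; ring
  have hw1 : ‖w.1‖ ≤ r ^ ρ := by simpa using hw.1
  have hw2 : ‖w.2‖ ≤ r ^ ρ := by simpa using hw.2
  have hX : 0 < ‖(z - w).1‖ := norm_pos_iff.2 (sub_ne_zero.2 hwz.symm)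
  have hX2 : ‖(z - w).1‖ ≤ 2 * r := (norm_sub_le z.1 w.1).trans (by linarith)
  have hY : ‖(z - w).2‖ ≤ 2 * r ^ ρ := (norm_sub_le z.2 w.2).trans (by linarith)
  have hS : ‖(z - w).1‖ ^ ρ + ‖(z - w).2‖ ≤ A * r ^ ρ := by
    have : ‖(z - w).1‖ ^ ρ ≤ (2 * r) ^ ρ := Real.rpow_le_rpow hX.le hX2 (by linarith)
    rw [Real.mul_rpow two_pos.le hr.le] at this
    rw [hA]
    linarith
  have hS0 : 0 < ‖(z - w).1‖ ^ ρ + ‖(z - w).2‖ := by positivity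
  have hX' : (z - w - (0, v)).1 = (z - w).1 := by simp
  have hS' : M * (‖(z - w).1‖ ^ ρ + ‖(z - w).2‖) ≤
      ‖(z - w).1‖ ^ ρ + ‖(z - w - (0, v)).2‖ := by
    have h1 := norm_sub_norm_le v (z - w).2
    rw [norm_sub_rev] at h1
    have e : (z - w - (0, v)).2 = (z - w).2 - v := rfl
    have h2 : 0 ≤ ‖(z - w).1‖ ^ ρ := by positivity
    have h3 : M * (‖(z - w).1‖ ^ ρ + ‖(z - w).2‖) ≤ M * (A * r ^ ρ) := by gcongr
    rw [e]
    linarith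
  rw [kernel_eq, kernel_eq, hX']
  constructor
  · calc _ ≤ ‖(z - w).1‖ ^ (-((n : ℝ) - α)) *
          (M * (‖(z - w).1‖ ^ ρ + ‖(z - w).2‖)) ^ (-((m : ℝ) - β)) := by
          refine mul_le_mul_of_nonneg_left ?_ (by positivity)
          exact Real.rpow_le_rpow_of_nonpos (by positivity) hS' (by linarith)
      _ = M ^ (-((m : ℝ) - β)) * (‖(z - w).1‖ ^ (-((n : ℝ) - α)) *
          (‖(z - w).1‖ ^ ρ + ‖(z - w).2‖) ^ (-((m : ℝ) - β))) := by
          rw [Real.mul_rpow (by linarith) hS0.le]; ring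
      _ ≤ 1 / 2 * (‖(z - w).1‖ ^ (-((n : ℝ) - α)) *
          (‖(z - w).1‖ ^ ρ + ‖(z - w).2‖) ^ (-((m : ℝ) - β))) := by gcongr
      _ = _ := by ring
  · refine mul_le_mul ?_ ?_ (by positivity) (by positivity)
    · exact Real.rpow_le_rpow_of_nonpos hX hX2 (by linarith)
    · exact Real.rpow_le_rpow_of_nonpos hS0 hS (by linarith)

/-- For every nonisotropic scale `r` some atom has a fractional integral of the size of the kernel
on the nonisotropic ball of radius `r`. -/
lemma exists_atom_large_on_box [NeZero n] [NeZero m] (hα : 0 < α) (hαn : α < n)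
    (hβ : 0 < β) (hβm : β < m) (hρ : 1 ≤ ρ) :
    ∃ c : ℝ, 0 < c ∧ ∀ r : ℝ, 0 < r → ∃ a : Space n m → 𝕜, IsAtom a ∧
      ∀ᵐ z : Space n m, z ∈ box n m r (r ^ ρ) →
        c * (r ^ (-((n : ℝ) - α)) * (r ^ ρ) ^ (-((m : ℝ) - β))) ≤
          ‖fracIntegral n m α β ρ a z‖ := by
  obtain ⟨c₁, hc₁, h₁⟩ := exists_dipole_atom_fst (𝕜 := 𝕜) hα hαn hβ hβm (by linarith : 0 < ρ)
  obtain ⟨c₂, hc₂, h₂⟩ := exists_dipole_atom_snd (𝕜 := 𝕜) hα hαn hβ hβm hρ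
  set A : ℝ := 2 ^ ρ + 2 with hA
  have hA0 : 0 < A := by positivity
  refine ⟨min (c₁ * A ^ (-((m : ℝ) - β))) c₂, lt_min (by positivity) hc₂, fun r hr => ?_⟩
  have hs : 0 < r ^ ρ := by positivity
  -- The dipole has cube scale min(r, r^ρ) and points along the variable whose natural scale is that
  -- minimum.
  rcases le_total r 1 with hr1 | hr1
  · obtain ⟨a, ha, hz⟩ := h₂ r hr hr1
    refine ⟨a, ha, ?_⟩
    filter_upwards [hz] with z hz hzb
    refine le_trans ?_ (hz hzb)
    gcongr
    exact min_le_right _ _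
  · obtain ⟨a, ha, hz⟩ := h₁ r hr
    refine ⟨a, ha, ?_⟩
    filter_upwards [hz] with z hz hzb
    have hz1 : ‖z.1‖ ≤ r := by simpa using hzb.1
    have hz2 : ‖z.2‖ ≤ r ^ ρ := by simpa using hzb.2
    have hrr : r ≤ r ^ ρ := by simpa using Real.rpow_le_rpow_of_exponent_le hr1 hρ
    refine le_trans ?_ (hz hz1)
    calc _ ≤ c₁ * A ^ (-((m : ℝ) - β)) *
          (r ^ (-((n : ℝ) - α)) * (r ^ ρ) ^ (-((m : ℝ) - β))) := by
          gcongr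
          exact min_le_left _ _
      _ = c₁ * (r ^ (-((n : ℝ) - α)) * (A * r ^ ρ) ^ (-((m : ℝ) - β))) := by
          rw [Real.mul_rpow hA0.le hs.le]; ring
      _ ≤ _ := by
          refine mul_le_mul_of_nonneg_left (mul_le_mul_of_nonneg_left ?_ (by positivity)) hc₁.le
          refine Real.rpow_le_rpow_of_nonpos (by positivity) ?_ (by linarith)
          rw [Real.mul_rpow two_pos.le hr.le, hA]
          linarith

lemma setLIntegral_rpow_le_of_eLpNorm_le (hq : 0 < q) {F : Space n m → 𝕜} {B : ℝ≥0∞}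
    (hB : eLpNorm F (ENNReal.ofReal q) volume ≤ B) {A : Set (Space n m)} (hA : MeasurableSet A)
    {g : Space n m → ℝ≥0∞} (hg : ∀ᵐ z, z ∈ A → g z ≤ ‖F z‖ₑ) :
    ∫⁻ z in A, g z ^ q ≤ B ^ q := by
  rw [eLpNorm_eq_lintegral_rpow_enorm_toReal (by simpa using hq) ENNReal.ofReal_ne_top,
    ENNReal.toReal_ofReal hq.le] at hB
  calc ∫⁻ z in A, g z ^ q ≤ ∫⁻ z in A, ‖F z‖ₑ ^ q := by
        refine lintegral_mono_ae ?_
        filter_upwards [(ae_restrict_iff' hA).2 hg] with z hz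
        gcongr
    _ ≤ ∫⁻ z, ‖F z‖ₑ ^ q := setLIntegral_le_lintegral _ _
    _ = ((∫⁻ z, ‖F z‖ₑ ^ q) ^ (1 / q)) ^ q := by
        rw [← ENNReal.rpow_mul, one_div_mul_cancel hq.ne', ENNReal.rpow_one]
    _ ≤ B ^ q := by gcongr

lemma eq_zero_of_forall_rpow_le {η K : ℝ} (h : ∀ r : ℝ, 0 < r → r ^ η ≤ K) : η = 0 := by
  by_contra hne
  have hK : 1 ≤ K := by simpa using h 1 one_pos
  -- At this r the power r^η equals K + 1.
  have := h ((K + 1) ^ (1 / η)) (by positivity)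
  rw [← Real.rpow_mul (by linarith), one_div_mul_cancel hne, Real.rpow_one] at this
  linarith

/-- Uniform boundedness on atoms forces the homogeneity relation. -/
lemma homogeneity_of_atom_bound [NeZero n] [NeZero m] (hα : 0 < α) (hαn : α < n)
    (hβ : 0 < β) (hβm : β < m) (hρ : 1 ≤ ρ) (hq : 1 < q) {B : ℝ≥0}
    (hB : ∀ a : Space n m → 𝕜, IsAtom a →
      eLpNorm (fracIntegral n m α β ρ a) (ENNReal.ofReal q) volume ≤ B) :
    n - q * (n - α) + ρ * (m - q * (m - β)) = 0 := by
  have hq0 : 0 < q := by linarith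
  obtain ⟨c, hc, H⟩ := exists_atom_large_on_box (𝕜 := 𝕜) hα hαn hβ hβm hρ
  have hV := toReal_volume_box_one_pos n m
  refine eq_zero_of_forall_rpow_le (K := B ^ q / (c ^ q * (volume (box n m 1 1)).toReal))
    fun r hr => ?_
  obtain ⟨a, ha, hz⟩ := H r hr
  have hs : 0 < r ^ ρ := by positivity
  set k : ℝ := c * (r ^ (-((n : ℝ) - α)) * (r ^ ρ) ^ (-((m : ℝ) - β))) with hk
  have hk0 : 0 < k := by positivity
  have h := setLIntegral_rpow_le_of_eLpNorm_le hq0 (hB a ha) (measurableSet_box r (r ^ ρ))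
    (g := fun _ => ENNReal.ofReal k) (by
      filter_upwards [hz] with z hz hzb
      rw [← ofReal_norm]
      exact ENNReal.ofReal_le_ofReal (hz hzb))
  rw [setLIntegral_const, ENNReal.ofReal_rpow_of_pos hk0] at h
  have hvol : volume (box n m r (r ^ ρ)) =
      ENNReal.ofReal (r ^ n * (r ^ ρ) ^ m) * volume (box n m 1 1) := by
    rw [box, box, Measure.volume_eq_prod, Measure.prod_prod, Measure.prod_prod,
      Measure.addHaar_closedBall' _ _ hr.le, Measure.addHaar_closedBall' _ _ hs.le,
      finrank_euclideanSpace_fin, finrank_euclideanSpace_fin, ENNReal.ofReal_mul (by positivity)]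
    ring
  have h' := ENNReal.toReal_mono (ENNReal.rpow_ne_top_of_nonneg hq0.le ENNReal.coe_ne_top) h
  rw [hvol, ENNReal.toReal_mul, ENNReal.toReal_mul, ENNReal.toReal_ofReal (by positivity),
    ENNReal.toReal_ofReal (by positivity), ← ENNReal.toReal_rpow, ENNReal.coe_toReal] at h'
  rw [le_div_iff₀ (by positivity)]
  refine le_trans (le_of_eq ?_) h'
  rw [hk, Real.mul_rpow hc.le (by positivity), Real.mul_rpow (by positivity) (by positivity),
    ← Real.rpow_mul hr.le, ← Real.rpow_mul hr.le, ← Real.rpow_mul hr.le, ← Real.rpow_natCast,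
    ← Real.rpow_natCast, ← Real.rpow_mul hr.le]
  have : r ^ ((n : ℝ) - q * (n - α) + ρ * (m - q * (m - β))) =
      r ^ (-((n : ℝ) - α) * q) * r ^ (ρ * (-((m : ℝ) - β) * q)) *
        (r ^ (n : ℝ) * r ^ (ρ * (m : ℝ))) := by
    rw [← Real.rpow_add hr, ← Real.rpow_add hr, ← Real.rpow_add hr]
    ring_nf
  rw [this]
  ring_nf

/-- Boundedness on a single atom forces decay of the kernel in the second variable. -/
lemma lt_mul_sub_of_atom_bound [NeZero n] [NeZero m] (hα : 0 < α) (hαn : α < n)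
    (hβ : 0 < β) (hβm : β < m) (hρ : 1 ≤ ρ) (hq : 1 < q) {B : ℝ≥0}
    (hB : ∀ a : Space n m → 𝕜, IsAtom a →
      eLpNorm (fracIntegral n m α β ρ a) (ENNReal.ofReal q) volume ≤ B) :
    m < q * (m - β) := by
  have hq0 : 0 < q := by linarith
  by_contra! hle
  obtain ⟨c, hc, H⟩ := exists_dipole_atom_fst (𝕜 := 𝕜) hα hαn hβ hβm (by linarith : 0 < ρ)
  obtain ⟨a, ha, hz⟩ := H 1 one_pos
  set A : ℝ := 2 ^ ρ + 2 with hA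
  have hA0 : 0 < A := by positivity
  set k : ℝ := c * A ^ (-((m : ℝ) - β)) with hk
  have hk0 : 0 < k := by positivity
  have hSm : MeasurableSet {y : EuclideanSpace ℝ (Fin m) | 1 ≤ ‖y‖} :=
    measurableSet_le measurable_const measurable_norm
  have h := setLIntegral_rpow_le_of_eLpNorm_le hq0 (hB a ha)
    ((Metric.isClosed_closedBall (x := (0 : EuclideanSpace ℝ (Fin n))) (ε := 1)).measurableSet.prod
      hSm)
    (g := fun z => ENNReal.ofReal k * normPow (m - β) z.2) (by
      filter_upwards [hz] with z hz hzb
      have hz1 : ‖z.1‖ ≤ 1 := by simpa using hzb.1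
      have hz2 : 1 ≤ ‖z.2‖ := hzb.2
      have hz0 : 0 < ‖z.2‖ := by linarith
      rw [normPow_of_ne (norm_pos_iff.1 hz0), ← ENNReal.ofReal_mul hk0.le, ← ofReal_norm]
      refine ENNReal.ofReal_le_ofReal (le_trans ?_ (hz hz1))
      rw [hk, mul_assoc, ← Real.mul_rpow hA0.le hz0.le, Real.one_rpow, one_mul, mul_one]
      refine mul_le_mul_of_nonneg_left ?_ hc.le
      refine Real.rpow_le_rpow_of_nonpos (by positivity) ?_ (by linarith)
      -- For |y| ≥ 1 this absorbs 2^ρ + 1 + |y| into A|y|.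
      have : (2 : ℝ) ^ ρ ≤ 2 ^ ρ * ‖z.2‖ := le_mul_of_one_le_right (by positivity) hz2
      rw [hA]
      linarith)
  have h2 : ∫⁻ z in Metric.closedBall (0 : EuclideanSpace ℝ (Fin n)) 1 ×ˢ
      {y : EuclideanSpace ℝ (Fin m) | 1 ≤ ‖y‖},
        (ENNReal.ofReal k * normPow (m - β) z.2) ^ q = ∞ := by
    simp_rw [ENNReal.mul_rpow_of_nonneg _ _ hq0.le, normPow_rpow]
    have := setLIntegral_prod_mul (volume : Measure (EuclideanSpace ℝ (Fin n)))
      (volume : Measure (EuclideanSpace ℝ (Fin m))) (Metric.closedBall 0 1) {y | 1 ≤ ‖y‖}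
      (f := fun _ => ENNReal.ofReal k ^ q) measurable_const (measurable_normPow (q * (m - β)))
    rw [← Measure.volume_eq_prod] at this
    rw [this, setLIntegral_norm_ge_normPow_eq_top volume (by simpa using hle), setLIntegral_const]
    refine ENNReal.mul_top (mul_ne_zero ?_ (Metric.measure_closedBall_pos _ _ one_pos).ne')
    rw [ENNReal.ofReal_rpow_of_pos hk0]
    simpa using Real.rpow_pos_of_pos hk0 q
  rw [h2, top_le_iff] at h
  exact ENNReal.rpow_ne_top_of_nonneg hq0.le ENNReal.coe_ne_top h

end Necessity

end FlagFractional

/-! ### The main theorem. -/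

theorem mainTheorem2 (𝕜 : Type*) [RCLike 𝕜] (n m : ℕ) (α β ρ q : ℝ)
    (hα : 0 < α) (hαn : α < n) (hβ : 0 < β) (hβm : β < m) (hρ : 1 ≤ ρ) (hq : 1 < q) :
    (∀ f : FlagFractional.Space n m → 𝕜, FlagFractional.MemHardy f →
      ∀ᵐ z, Integrable (fun w => FlagFractional.kernel n m α β ρ (z - w) • f w)) ∧
    ((∃ B : ℝ≥0, ∀ f : FlagFractional.Space n m → 𝕜, FlagFractional.MemHardy f →
        MemLp (FlagFractional.fracIntegral n m α β ρ f) (ENNReal.ofReal q) volume ∧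
        eLpNorm (FlagFractional.fracIntegral n m α β ρ f) (ENNReal.ofReal q) volume
          ≤ B * FlagFractional.hardyNorm f) ↔
      (α / n > β / m ∧ (α + ρ * β) / (n + ρ * m) = 1 - 1 / q)) := by
  have hn0 : (0 : ℝ) < n := hα.trans hαn
  have hm0 : (0 : ℝ) < m := hβ.trans hβm
  have : NeZero n := ⟨by rintro rfl; simp at hn0⟩
  have : NeZero m := ⟨by rintro rfl; simp at hm0⟩
  have hq0 : 0 < q := by linarith
  have hρ0 : 0 < ρ := by linarith
  have hnm : 0 < n + ρ * m := by positivity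
  have hhom_iff : (α + ρ * β) / (n + ρ * m) = 1 - 1 / q ↔
      n - q * (n - α) + ρ * (m - q * (m - β)) = 0 := by
    rw [div_eq_iff hnm.ne', one_sub_div hq0.ne', div_mul_eq_mul_div, eq_div_iff hq0.ne']
    constructor <;> intro h <;> linear_combination h
  have hlt_iff : α / n > β / m ↔ β * n < α * m := by rw [gt_iff_lt, div_lt_div_iff₀ hm0 hn0]
  refine ⟨fun f ⟨_, _, hf⟩ => FlagFractional.ae_integrable_kernel_smul hα hαn hβ hβm hf.1, ?_⟩
  rw [hhom_iff, hlt_iff]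
  constructor
  · rintro ⟨B, hB⟩
    have hatom : ∀ a : FlagFractional.Space n m → 𝕜, FlagFractional.IsAtom a →
        eLpNorm (FlagFractional.fracIntegral n m α β ρ a) (ENNReal.ofReal q) volume ≤ B := by
      intro a ha
      refine (hB a ha.memHardy).2.trans ?_
      calc (B : ℝ≥0∞) * FlagFractional.hardyNorm a ≤ B * 1 := by
            gcongr; exact ha.hardyNorm_le_one
        _ = B := mul_one _
    have hhom := FlagFractional.homogeneity_of_atom_bound hα hαn hβ hβm hρ hq hatom
    have hqβ := FlagFractional.lt_mul_sub_of_atom_bound hα hαn hβ hβm hρ hq hatom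
    refine ⟨?_, hhom⟩
    -- By homogeneity the decay in y forces local integrability in x; then qβn < (q-1)mn < qαm.
    have hqα : q * (n - α) < n := by nlinarith
    have h1 : (q - 1) * n * m < q * α * m := by
      refine mul_lt_mul_of_pos_right ?_ hm0
      linarith
    have h2 : q * β * n < (q - 1) * m * n := by
      refine mul_lt_mul_of_pos_right ?_ hn0
      linarith
    refine lt_of_mul_lt_mul_left ?_ hq0.le
    linarith
  · rintro ⟨hlt, hhom⟩
    -- Otherwise homogeneity reverses both integrability conditions, and qαm ≤ (q-1)nm ≤ qβn
    -- contradicts `hlt`.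
    have hqα : q * (n - α) < n := by
      by_contra! hcon
      have hβ' : q * (m - β) ≤ m := by nlinarith
      have h1 : q * α * m ≤ (q - 1) * n * m := by
        refine mul_le_mul_of_nonneg_right ?_ hm0.le
        linarith
      have h2 : (q - 1) * m * n ≤ q * β * n := by
        refine mul_le_mul_of_nonneg_right ?_ hn0.le
        linarith
      nlinarith
    have hqβ : m < q * (m - β) := by nlinarith
    obtain ⟨C, hC⟩ := FlagFractional.exists_eLpNorm_fracIntegral_atom_le (𝕜 := 𝕜) hα hαn hβ hβm hρ
      hq hqα hqβ hhom
    exact ⟨C, fun f hf => FlagFractional.eLpNorm_fracIntegral_le_hardyNorm hα hαn hβ hβm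
      (by simpa using hq.le) hC hf⟩
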